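/- **Definitions.** Let $\Sigma,\Gamma$ be finite (disjoint) alphabets. An *origin graph* from $\Sigma$ to $\Gamma$ is a pair $w=(u,(v,o))$ where $u\in\Sigma^+$ is a non-empty input word, $v\in\Gamma^*$ is an output word, and $o:\mathrm{dom}(v)\to\mathrm{dom}(u)$ maps output positions to input positions. It is seen as a structure with domain $\mathrm{dom}(u)\uplus\mathrm{dom}(v)$, with the output labels $\gamma(x)$ for $\gamma\in\Gamma$ (true exactly at the output positions labelled $\gamma$), the linear order $\le_{\mathsf{out}}$ on output positions, and a unary function $\mathsf{o}$ interpreted by $o$ on $\mathrm{dom}(v)$ and by the identity on $\mathrm{dom}(u)$. For $n\in\{0,1,2\}$, every formula $\varphi$ of monadic second-order logic over words (signature: the labels $\sigma\in\Sigma$ and the linear order $\le_{\mathsf{in}}$ on positions) with at most $n$ free first-order variables and no free second-order variable yields an $n$-ary predicate $\{\varphi\}$, interpreted in $w$ by the $n$-ary relation that $\varphi$ defines on the positions of $u$. The logic $\mathcal L_T$ is the two-variable fragment of first-order logic with equality over the predicates $\gamma(x)$ for $\gamma\in\Gamma$, $\le_{\mathsf{out}}$, the function $\mathsf{o}$, and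 all the predicates $\{\varphi\}$. For an $\mathcal L_T$-sentence $\phi$, the origin transduction $[\![\phi]\!]_{\mathsf o}$ is the set of origin graphs from $\Sigma$ to $\Gamma$ that satisfy $\phi$. **Theorem.** 1. The satisfiability problem of $\mathcal L_T$ over origin graphs is decidable: there is an algorithm that, given finite alphabets $\Sigma,\Gamma$ and an $\mathcal L_T$-sentence $\phi$ over them, decides whether $[\![\phi]\!]_{\mathsf o}\neq\varnothing$. 2. $\mathcal L_T$ is closed under negation: for every $\mathcal L_T$-sentence $\phi$, $\neg\phi$ is an $\mathcal L_T$-sentence over the same alphabets, and $[\![\neg\phi]\!]_{\mathsf o}$ is the complement of $[\![\phi]\!]_{\mathsf o}$ in the set of all origin graphs from $\Sigma$ to $\Gamma$. 3. The equivalence problem of $\mathcal L_T$ is decidable: there is an algorithm that, given finite alphabets $\Sigma,\Gamma$ and $\mathcal L_T$-sentences $\phi_1,\phi_2$ over them, decides whether $[\![\phi_1]\!]_{\mathsf o}=[\![\phi_2]\!]_{\mathsf o}$. -/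

import Mathlib

namespace OriginLogic

/-! ### Origin graphs -/

/-- An origin graph `(u, (v, o))` over the input alphabet `{0, …, s - 1}` and the output
alphabet `{0, …, g - 1}`: a non-empty input word, an output word, and an origin mapping from the
positions of the output to the positions of the input.  The two alphabets are kept apart by their
types. -/
structure OGraph (s g : ℕ) where
  input : List (Fin s)
  input_ne_nil : input ≠ []
  output : List (Fin g)
  origin : Fin output.length → Fin input.length

namespace OGraph

variable {s g : ℕ}

abbrev InPos (w : OGraph s g) : Type := Fin w.input.length

abbrev OutPos (w : OGraph s g) : Type := Fin w.output.length

/-- The domain of `w` seen as a structure: the disjoint union of input and output positions. -/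
abbrev Pos (w : OGraph s g) : Type := w.InPos ⊕ w.OutPos

def firstPos (w : OGraph s g) : w.InPos := ⟨0, List.length_pos_iff.mpr w.input_ne_nil⟩

/-- The interpretation of the unary function symbol `o`: the origin mapping on output positions,
the identity on input positions. -/
def originFun (w : OGraph s g) : w.Pos → w.Pos
  | .inl i => .inl i
  | .inr j => .inl (w.origin j)

end OGraph

/-! ### Monadic second-order logic over the input word -/

/-- Formulas of monadic second-order logic over words, with label predicates and the linear order
on positions.  First-order variables, second-order variables and letters are named by natural
numbers.  The other connectives and quantifiers are the usual abbreviations. -/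
inductive MSO : Type
  | label (a x : ℕ) : MSO
  | le (x y : ℕ) : MSO
  | eq (x y : ℕ) : MSO
  | mem (x X : ℕ) : MSO
  | neg (φ : MSO) : MSO
  | and (φ ψ : MSO) : MSO
  | ex (x : ℕ) (φ : MSO) : MSO
  | exSet (X : ℕ) (φ : MSO) : MSO

namespace MSO

/-- Satisfaction in a word `u`, under an assignment `ρ` of the first-order variables and an
assignment `S` of the second-order variables. -/
def Holds {s : ℕ} (u : List (Fin s)) :
    MSO → (ℕ → Fin u.length) → (ℕ → Set (Fin u.length)) → Prop
  | label a x, ρ, _ => (u.get (ρ x) : ℕ) = a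
  | le x y, ρ, _ => ρ x ≤ ρ y
  | eq x y, ρ, _ => ρ x = ρ y
  | mem x X, ρ, S => ρ x ∈ S X
  | neg φ, ρ, S => ¬ φ.Holds u ρ S
  | and φ ψ, ρ, S => φ.Holds u ρ S ∧ ψ.Holds u ρ S
  | ex x φ, ρ, S => ∃ i, φ.Holds u (Function.update ρ x i) S
  | exSet X φ, ρ, S => ∃ P, φ.Holds u ρ (Function.update S X P)

/-- The free first-order variables. -/
def freeVars : MSO → Finset ℕ
  | label _ x => {x}
  | le x y => {x, y}
  | eq x y => {x, y}
  | mem x _ => {x}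
  | neg φ => φ.freeVars
  | and φ ψ => φ.freeVars ∪ ψ.freeVars
  | ex x φ => φ.freeVars.erase x
  | exSet _ φ => φ.freeVars

/-- The free second-order variables. -/
def freeSetVars : MSO → Finset ℕ
  | label _ _ => ∅
  | le _ _ => ∅
  | eq _ _ => ∅
  | mem _ X => {X}
  | neg φ => φ.freeSetVars
  | and φ ψ => φ.freeSetVars ∪ ψ.freeSetVars
  | ex _ φ => φ.freeSetVars
  | exSet X φ => φ.freeSetVars.erase X

/-- Every letter of the formula belongs to the alphabet `{0, …, s - 1}`. -/
def IsOver (s : ℕ) : MSO → Prop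
  | label a _ => a < s
  | le _ _ => True
  | eq _ _ => True
  | mem _ _ => True
  | neg φ => φ.IsOver s
  | and φ ψ => φ.IsOver s ∧ ψ.IsOver s
  | ex _ φ => φ.IsOver s
  | exSet _ φ => φ.IsOver s

/-- The formula defines an `n`-ary predicate on the positions of words over `{0, …, s - 1}`: its
free first-order variables are among `0, …, n - 1`, and it has no free second-order variable. -/
def IsPredicate (s n : ℕ) (φ : MSO) : Prop :=
  φ.IsOver s ∧ (∀ x ∈ φ.freeVars, x < n) ∧ φ.freeSetVars = ∅

/-- Gödel number of a formula. -/
def code : MSO → ℕ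
  | label a x => 8 * Nat.pair a x
  | le x y => 8 * Nat.pair x y + 1
  | eq x y => 8 * Nat.pair x y + 2
  | mem x X => 8 * Nat.pair x X + 3
  | neg φ => 8 * φ.code + 4
  | and φ ψ => 8 * Nat.pair φ.code ψ.code + 5
  | ex x φ => 8 * Nat.pair x φ.code + 6
  | exSet X φ => 8 * Nat.pair X φ.code + 7

theorem exists_code_eq (n : ℕ) : ∃ φ : MSO, φ.code = n := by
  induction n using Nat.strong_induction_on with
  | _ n ih =>
    have hp : Nat.pair (n / 8).unpair.1 (n / 8).unpair.2 = n / 8 := Nat.pair_unpair _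
    have h1 := Nat.unpair_left_le (n / 8)
    have h2 := Nat.unpair_right_le (n / 8)
    have hcases : n % 8 = 0 ∨ n % 8 = 1 ∨ n % 8 = 2 ∨ n % 8 = 3 ∨ n % 8 = 4 ∨ n % 8 = 5 ∨
      n % 8 = 6 ∨ n % 8 = 7 := by omega
    rcases hcases with h | h | h | h | h | h | h | h
    · exact ⟨label (n / 8).unpair.1 (n / 8).unpair.2, by rw [code, hp]; omega⟩
    · exact ⟨le (n / 8).unpair.1 (n / 8).unpair.2, by rw [code, hp]; omega⟩
    · exact ⟨eq (n / 8).unpair.1 (n / 8).unpair.2, by rw [code, hp]; omega⟩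
    · exact ⟨mem (n / 8).unpair.1 (n / 8).unpair.2, by rw [code, hp]; omega⟩
    · obtain ⟨φ, hφ⟩ := ih (n / 8) (by omega)
      exact ⟨neg φ, by rw [code, hφ]; omega⟩
    · obtain ⟨φ, hφ⟩ := ih (n / 8).unpair.1 (by omega)
      obtain ⟨ψ, hψ⟩ := ih (n / 8).unpair.2 (by omega)
      exact ⟨and φ ψ, by rw [code, hφ, hψ, hp]; omega⟩
    · obtain ⟨φ, hφ⟩ := ih (n / 8).unpair.2 (by omega)
      exact ⟨ex (n / 8).unpair.1 φ, by rw [code, hφ, hp]; omega⟩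
    · obtain ⟨φ, hφ⟩ := ih (n / 8).unpair.2 (by omega)
      exact ⟨exSet (n / 8).unpair.1 φ, by rw [code, hφ, hp]; omega⟩

theorem code_injective : Function.Injective code := by
  intro φ
  induction φ <;> intro χ h <;> cases χ <;> simp only [code] at h <;>
    first
    | omega
    | (simp only [Nat.add_right_cancel_iff, mul_eq_mul_left_iff, Nat.pair_eq_pair] at h; grind)

end MSO

/-! ### The logic `L_T` -/

/-- Terms over the two variables `false` and `true` and the unary function symbol `o`. -/
inductive Term : Type
  | var (v : Bool) : Term
  | origin (t : Term) : Term

namespace Term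

def eval {s g : ℕ} (w : OGraph s g) (ν : Bool → w.Pos) : Term → w.Pos
  | var v => ν v
  | origin t => w.originFun (t.eval w ν)

def freeVars : Term → Finset Bool
  | var v => {v}
  | origin t => t.freeVars

/-- Gödel number of a term. -/
def code : Term → ℕ
  | var v => v.toNat
  | origin t => t.code + 2

theorem exists_code_eq (n : ℕ) : ∃ t : Term, t.code = n := by
  induction n using Nat.strong_induction_on with
  | _ n ih =>
    match n with
    | 0 => exact ⟨var false, rfl⟩
    | 1 => exact ⟨var true, rfl⟩
    | m + 2 =>
      obtain ⟨t, ht⟩ := ih m (by omega)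
      exact ⟨origin t, by rw [code, ht]⟩

theorem code_injective : Function.Injective code := by
  intro t
  induction t with
  | var v =>
    intro t' h
    cases t' with
    | var v' => cases v <;> cases v' <;> simp_all [code]
    | origin t' => cases v <;> simp [code] at h
  | origin t ih =>
    intro t' h
    cases t' with
    | var v' => cases v' <;> simp [code] at h
    | origin t' => rw [ih (by simpa [code] using h)]

end Term

/-- Formulas of `L_T`, the two-variable fragment of first-order logic over the output labels, the
output order, the origin function and all monadic second-order definable predicates of arity
`0`, `1` and `2` on the input positions.  The variables are `false` and `true`.  The other
connectives and the universal quantifier are the usual abbreviations. -/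
inductive LT : Type
  | label (b : ℕ) (t : Term) : LT
  | le (t t' : Term) : LT
  | eq (t t' : Term) : LT
  | pred0 (α : MSO) : LT
  | pred1 (α : MSO) (t : Term) : LT
  | pred2 (α : MSO) (t t' : Term) : LT
  | neg (φ : LT) : LT
  | and (φ ψ : LT) : LT
  | ex (v : Bool) (φ : LT) : LT

namespace LT

/-- Satisfaction in an origin graph under an assignment of the two variables.  Label and order
atoms speak about output positions only, and the predicates defined by monadic second-order
formulas about input positions only; such an atom is false at positions of the other kind.  In
`pred1` and `pred2` the first argument interprets the variable `0` and the second one the variable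
`1`; the values of all other variables are irrelevant for a formula of the right arity. -/
def Holds {s g : ℕ} (w : OGraph s g) : LT → (Bool → w.Pos) → Prop
  | label b t, ν => ∃ j, t.eval w ν = .inr j ∧ (w.output.get j : ℕ) = b
  | le t t', ν => ∃ j j', t.eval w ν = .inr j ∧ t'.eval w ν = .inr j' ∧ j ≤ j'
  | eq t t', ν => t.eval w ν = t'.eval w ν
  | pred0 α, _ => α.Holds w.input (fun _ => w.firstPos) (fun _ => ∅)
  | pred1 α t, ν => ∃ i, t.eval w ν = .inl i ∧ α.Holds w.input (fun _ => i) (fun _ => ∅)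
  | pred2 α t t', ν => ∃ i i', t.eval w ν = .inl i ∧ t'.eval w ν = .inl i' ∧
      α.Holds w.input (fun k => if k = 0 then i else i') (fun _ => ∅)
  | neg φ, ν => ¬ φ.Holds w ν
  | and φ ψ, ν => φ.Holds w ν ∧ ψ.Holds w ν
  | ex v φ, ν => ∃ p, φ.Holds w (Function.update ν v p)

def freeVars : LT → Finset Bool
  | label _ t => t.freeVars
  | le t t' => t.freeVars ∪ t'.freeVars
  | eq t t' => t.freeVars ∪ t'.freeVars
  | pred0 _ => ∅
  | pred1 _ t => t.freeVars
  | pred2 _ t t' => t.freeVars ∪ t'.freeVars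
  | neg φ => φ.freeVars
  | and φ ψ => φ.freeVars ∪ ψ.freeVars
  | ex v φ => φ.freeVars.erase v

/-- The formula is an `L_T`-formula over the input alphabet `{0, …, s - 1}` and the output
alphabet `{0, …, g - 1}`. -/
def IsOver (s g : ℕ) : LT → Prop
  | label b _ => b < g
  | le _ _ => True
  | eq _ _ => True
  | pred0 α => α.IsPredicate s 0
  | pred1 α _ => α.IsPredicate s 1
  | pred2 α _ _ => α.IsPredicate s 2
  | neg φ => φ.IsOver s g
  | and φ ψ => φ.IsOver s g ∧ ψ.IsOver s g
  | ex _ φ => φ.IsOver s g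

/-- The formula is an `L_T`-sentence over the given alphabets. -/
def IsSentence (s g : ℕ) (φ : LT) : Prop :=
  φ.IsOver s g ∧ φ.freeVars = ∅

/-- The origin transduction defined by a sentence.  The assignment is irrelevant for a formula
without free variables. -/
def transduction (s g : ℕ) (φ : LT) : Set (OGraph s g) :=
  {w | φ.Holds w (fun _ => .inl w.firstPos)}

/-- Gödel number of a formula. -/
def code : LT → ℕ
  | label b t => 10 * Nat.pair b t.code
  | le t t' => 10 * Nat.pair t.code t'.code + 1
  | eq t t' => 10 * Nat.pair t.code t'.code + 2
  | pred0 α => 10 * α.code + 3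
  | pred1 α t => 10 * Nat.pair α.code t.code + 4
  | pred2 α t t' => 10 * Nat.pair α.code (Nat.pair t.code t'.code) + 5
  | neg φ => 10 * φ.code + 6
  | and φ ψ => 10 * Nat.pair φ.code ψ.code + 7
  | ex false φ => 10 * φ.code + 8
  | ex true φ => 10 * φ.code + 9

theorem exists_code_eq (n : ℕ) : ∃ φ : LT, φ.code = n := by
  induction n using Nat.strong_induction_on with
  | _ n ih =>
    have hp : Nat.pair (n / 10).unpair.1 (n / 10).unpair.2 = n / 10 := Nat.pair_unpair _
    have hq := Nat.pair_unpair (n / 10).unpair.2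
    have h1 := Nat.unpair_left_le (n / 10)
    have h2 := Nat.unpair_right_le (n / 10)
    obtain ⟨t₁, ht₁⟩ := Term.exists_code_eq (n / 10).unpair.1
    obtain ⟨t₂, ht₂⟩ := Term.exists_code_eq (n / 10).unpair.2
    obtain ⟨t₃, ht₃⟩ := Term.exists_code_eq (n / 10).unpair.2.unpair.1
    obtain ⟨t₄, ht₄⟩ := Term.exists_code_eq (n / 10).unpair.2.unpair.2
    obtain ⟨α₀, hα₀⟩ := MSO.exists_code_eq (n / 10)
    obtain ⟨α, hα⟩ := MSO.exists_code_eq (n / 10).unpair.1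
    have hcases : n % 10 = 0 ∨ n % 10 = 1 ∨ n % 10 = 2 ∨ n % 10 = 3 ∨ n % 10 = 4 ∨ n % 10 = 5 ∨
      n % 10 = 6 ∨ n % 10 = 7 ∨ n % 10 = 8 ∨ n % 10 = 9 := by omega
    rcases hcases with h | h | h | h | h | h | h | h | h | h
    · exact ⟨label (n / 10).unpair.1 t₂, by rw [code, ht₂, hp]; omega⟩
    · exact ⟨le t₁ t₂, by rw [code, ht₁, ht₂, hp]; omega⟩
    · exact ⟨eq t₁ t₂, by rw [code, ht₁, ht₂, hp]; omega⟩
    · exact ⟨pred0 α₀, by rw [code, hα₀]; omega⟩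
    · exact ⟨pred1 α t₂, by rw [code, hα, ht₂, hp]; omega⟩
    · exact ⟨pred2 α t₃ t₄, by rw [code, hα, ht₃, ht₄, hq, hp]; omega⟩
    · obtain ⟨φ, hφ⟩ := ih (n / 10) (by omega)
      exact ⟨neg φ, by rw [code, hφ]; omega⟩
    · obtain ⟨φ, hφ⟩ := ih (n / 10).unpair.1 (by omega)
      obtain ⟨ψ, hψ⟩ := ih (n / 10).unpair.2 (by omega)
      exact ⟨and φ ψ, by rw [code, hφ, hψ, hp]; omega⟩
    · obtain ⟨φ, hφ⟩ := ih (n / 10) (by omega)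
      exact ⟨ex false φ, by rw [code, hφ]; omega⟩
    · obtain ⟨φ, hφ⟩ := ih (n / 10) (by omega)
      exact ⟨ex true φ, by rw [code, hφ]; omega⟩

theorem code_injective : Function.Injective code := by
  intro φ
  induction φ with
  | ex v φ ih =>
    intro χ h
    cases v <;> rcases χ with _ | _ | _ | _ | _ | _ | _ | _ | ⟨_ | _, _⟩ <;>
      simp only [code] at h <;> first | omega | grind
  | _ =>
    intro χ h
    rcases χ with _ | _ | _ | _ | _ | _ | _ | _ | ⟨_ | _, _⟩ <;> simp only [code] at h <;>
      first
      | omega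
      | (simp only [Nat.add_right_cancel_iff, mul_eq_mul_left_iff, Nat.pair_eq_pair,
          MSO.code_injective.eq_iff, Term.code_injective.eq_iff] at h; grind)

/-- The Gödel numbering is a bijection between formulas and natural numbers. -/
noncomputable def equivNat : LT ≃ ℕ :=
  Equiv.ofBijective code ⟨code_injective, exists_code_eq⟩

/-- Computability on formulas refers to their Gödel numbers. -/
noncomputable instance : Primcodable LT := Primcodable.ofEquiv ℕ equivNat

theorem encode_eq_code (φ : LT) : Encodable.encode φ = φ.code := rfl

end LT

end OriginLogic

/-!
Decidability rests on a small model property with a computable bound; an exhaustive search over all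
origin graphs up to the bound, with a primitive recursive model checker, then decides
satisfiability.  No automaton is ever constructed: automata theory enters only as the existence of
finite monoids of bounded size.

*Monoids.*  By induction on the formula, every MSO formula is recognized by a finite monoid whose
size is bounded by a tower of exponentials (`MSO.recognizedBy_tower`); quantifiers lead to
powersets.  Hence one finite monoid decides all binary predicates with Gödel number below `N`,
reading words with two marked positions (`MSO.exists_markProd`).

*Bisimulation.*  The type of an element is the set of formulas with Gödel number below `N` that it
satisfies when assigned to both variables.  As a formula that begins with a quantifier depends on
one variable only, two graphs satisfy the same sentences below `N` as soon as the pairs of elements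
match, back and forth, in their types, labels and binary atoms (`OGraph.Similar.holds_iff`).

*Few outputs per input position.*  Among the output positions with a common origin, type and label
only the first and the last are needed: any other witness above, or below, a given element can be
replaced by one of them (`OGraph.exists_equivalent_output_le`).

*Short inputs.*  Cut the input word before a position `c`; this splits all elements into a left and
a right part.  The binary MSO predicates between the two parts depend only on the finitely many
classes of elements (`OGraph.cls`), so the only unbounded information that crosses the cut is the
output order.  It suffices to know it for the landmarks, the extremal elements of each class.
Elements of one part have a height relative to the landmarks.  If two cuts have the same profile,
i.e. their landmarks are arranged in the same way, then the left part of the first and the right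
part of the second fit together: merge their outputs by height
(`OGraph.exists_equivalent_of_profile_eq`).  There are boundedly many profiles, so minimal inputs
are short (`OGraph.exists_equivalent_length_le`).

*Model checking.*  Words, output words, origin maps and assignments are coded by the digits of
natural numbers.  Satisfaction at a pair of a formula and an assignment is computed from the table
of the truth values at all pairs with a smaller formula (`primrecPred_of_table`,
`MSO.primrecPred_check`, `LT.primrecPred_check`).  Equivalence of `φ` and `ψ` is the
unsatisfiability of `φ ∧ ¬ψ` and of `ψ ∧ ¬φ`.
-/

namespace OriginLogic

/-! ### Finite monoids for monadic second-order logic -/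

/-- The tower of exponentials `2 ^ 2 ^ ⋯ ^ 2` of the given height. -/
def tower : ℕ → ℕ
  | 0 => 1
  | k + 1 => 2 ^ tower k

theorem tower_mono : Monotone tower :=
  monotone_nat_of_le_succ fun _ => Nat.lt_two_pow_self.le

theorem four_mul_le_two_pow {x : ℕ} (hx : 4 ≤ x) : 4 * x ≤ 2 ^ x := by
  induction x, hx using Nat.le_induction with
  | base => norm_num
  | succ n hn ih => rw [pow_succ]; omega

theorem four_le_tower (k : ℕ) : 4 ≤ tower (k + 2) :=
  le_trans (by norm_num [tower]) (tower_mono (by omega : 2 ≤ k + 2))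

/-- The monoid `{1, ff, tt}` in which a product equals its first factor different from `1`. -/
def FirstBit : Type := Option Bool

namespace FirstBit

instance : Fintype FirstBit := inferInstanceAs (Fintype (Option Bool))

instance : Monoid FirstBit where
  one := (none : Option Bool)
  mul a b := match a with
    | none => b
    | some c => some c
  mul_assoc a b c := by cases a <;> rfl
  one_mul a := rfl
  mul_one a := by cases a <;> rfl

/-- The element that carries the truth value of `p`. -/
noncomputable def bit (p : Prop) : FirstBit := open Classical in some (decide p)

theorem bit_mul (p : Prop) (a : FirstBit) : bit p * a = bit p := rfl

theorem bit_eq_bit_true_iff {p : Prop} : bit p = bit True ↔ p := by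
  constructor
  · intro h
    have := Option.some.inj h
    simpa using this
  · intro h
    rw [eq_true h]

theorem card_eq : Fintype.card FirstBit = 3 := rfl

open Classical in
/-- A product over the positions of a word reads off the property `E` at the first position
satisfying `D`. -/
theorem prod_ofFn {n : ℕ} (D E : Fin n → Prop) (l₀ : Fin n) (h : ∀ l < l₀, ¬ D l) (h₀ : D l₀) :
    (List.ofFn fun l => if D l then bit (E l) else 1).prod = bit (E l₀) := by
  induction n with
  | zero => exact l₀.elim0
  | succ n ih =>
    rw [List.ofFn_succ, List.prod_cons]
    induction l₀ using Fin.cases with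
    | zero => rw [if_pos h₀, bit_mul]
    | succ l₀ =>
      rw [if_neg (h 0 (Fin.succ_pos _)), one_mul]
      exact ih (fun l => D l.succ) (fun l => E l.succ) l₀
        (fun l hl => h l.succ (Fin.succ_lt_succ_iff.mpr hl)) h₀

end FirstBit

open DualNumber

/-- The dual numbers over `𝔽₂` as a multiplicative monoid: since `ε * ε = 0`, a power of `ε`
tells the exponents `0`, `1` and `≥ 2` apart. -/
abbrev Counter : Type := DualNumber (ZMod 2)

namespace Counter

instance : Fintype Counter := inferInstanceAs (Fintype (ZMod 2 × ZMod 2))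

theorem card_eq : Fintype.card Counter = 4 := rfl

open Classical in
theorem prod_ofFn_eq_eps {n : ℕ} (b : Fin n → Prop) :
    (List.ofFn fun l => if b l then (ε : Counter) else 1).prod = ε ↔ ∃ i, ∀ l, b l ↔ l = i := by
  have he0 : (0 : Counter) ≠ ε := fun h => by simpa using congrArg TrivSqZeroExt.snd h
  have he1 : (1 : Counter) ≠ ε := fun h => by simpa using congrArg TrivSqZeroExt.snd h
  rw [List.prod_ofFn, Finset.prod_ite, Finset.prod_const, Finset.prod_const_one, mul_one]
  constructor
  · intro hp
    have hc : (Finset.univ.filter b).card = 1 := by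
      rcases hk : (Finset.univ.filter b).card with _ | _ | k
      · rw [hk, pow_zero] at hp
        exact absurd hp he1
      · rfl
      · rw [hk, pow_succ, pow_succ, mul_assoc, eps_mul_eps, mul_zero] at hp
        exact absurd hp he0
    obtain ⟨i, hi⟩ := Finset.card_eq_one.mp hc
    refine ⟨i, fun l => ?_⟩
    have := congrArg (fun A => l ∈ A) hi
    simpa using this
  · rintro ⟨i, hi⟩
    have : Finset.univ.filter b = {i} := by ext l; simp [hi]
    rw [this, Finset.card_singleton, pow_one]

end Counter

namespace MSO

variable {s : ℕ}

/-- The product over the positions of `u` of the values of a letter map `f`, which reads at each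
position the letter and the first-order and second-order variables that mark the position. -/
def wordProd {M : Type} [Monoid M] (f : Fin s → Set ℕ → Set ℕ → M) (u : List (Fin s))
    (ρ : ℕ → Fin u.length) (S : ℕ → Set (Fin u.length)) : M :=
  (List.ofFn fun l => f (u.get l) {x | ρ x = l} {X | l ∈ S X}).prod

/-- A finite monoid with at most `k` elements recognizes the words with assignments that satisfy
the formula. -/
def RecognizedBy (s k : ℕ) (α : MSO) : Prop :=
  ∃ (M : Type) (_ : Monoid M) (_ : Fintype M) (f : Fin s → Set ℕ → Set ℕ → M) (acc : Set M),
    Fintype.card M ≤ k ∧ ∀ u ρ S, α.Holds u ρ S ↔ wordProd f u ρ S ∈ acc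

theorem RecognizedBy.mono {k k' : ℕ} {α : MSO} (h : RecognizedBy s k α) (hk : k ≤ k') :
    RecognizedBy s k' α := by
  obtain ⟨M, i₁, i₂, f, acc, hM, h⟩ := h
  exact ⟨M, i₁, i₂, f, acc, hM.trans hk, h⟩

/-- Atomic formulas ask for a property `E` of the first position whose marks satisfy `D`. -/
theorem recognizedBy_of_first {α : MSO} (D : Set ℕ → Prop) (E : Fin s → Set ℕ → Set ℕ → Prop)
    (h : ∀ (u : List (Fin s)) ρ S, ∃ l₀, (∀ l < l₀, ¬ D {x | ρ x = l}) ∧ D {x | ρ x = l₀} ∧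
      (α.Holds u ρ S ↔ E (u.get l₀) {x | ρ x = l₀} {X | l₀ ∈ S X})) :
    RecognizedBy s 4 α := by
  classical
  refine ⟨FirstBit, inferInstance, inferInstance,
    fun a P Q => if D P then FirstBit.bit (E a P Q) else 1, {FirstBit.bit True},
    by rw [FirstBit.card_eq]; norm_num, fun u ρ S => ?_⟩
  obtain ⟨l₀, h₁, h₂, h₃⟩ := h u ρ S
  rw [h₃, Set.mem_singleton_iff, wordProd, FirstBit.prod_ofFn (fun l => D {x | ρ x = l})
    (fun l => E (u.get l) {x | ρ x = l} {X | l ∈ S X}) l₀ h₁ h₂, FirstBit.bit_eq_bit_true_iff]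

theorem recognizedBy_neg {k : ℕ} {α : MSO} (h : RecognizedBy s k α) :
    RecognizedBy s k α.neg := by
  obtain ⟨M, i₁, i₂, f, acc, hM, h⟩ := h
  exact ⟨M, i₁, i₂, f, accᶜ, hM, fun u ρ S => by simp [Holds, h]⟩

theorem recognizedBy_and {k k' : ℕ} {α β : MSO} (hα : RecognizedBy s k α)
    (hβ : RecognizedBy s k' β) : RecognizedBy s (k * k') (α.and β) := by
  obtain ⟨M, i₁, i₂, f, acc, hM, h⟩ := hα
  obtain ⟨M', i₁', i₂', f', acc', hM', h'⟩ := hβ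
  refine ⟨M × M', inferInstance, inferInstance, fun a P Q => (f a P Q, f' a P Q), acc ×ˢ acc',
    by rw [Fintype.card_prod]; exact Nat.mul_le_mul hM hM', fun u ρ S => ?_⟩
  have h1 : (wordProd (fun a P Q => (f a P Q, f' a P Q)) u ρ S).1 = wordProd f u ρ S := by
    have := map_list_prod (MonoidHom.fst M M')
      (List.ofFn fun l => (f (u.get l) {x | ρ x = l} {X | l ∈ S X},
        f' (u.get l) {x | ρ x = l} {X | l ∈ S X}))
    rw [List.map_ofFn] at this
    exact this
  have h2 : (wordProd (fun a P Q => (f a P Q, f' a P Q)) u ρ S).2 = wordProd f' u ρ S := by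
    have := map_list_prod (MonoidHom.snd M M')
      (List.ofFn fun l => (f (u.get l) {x | ρ x = l} {X | l ∈ S X},
        f' (u.get l) {x | ρ x = l} {X | l ∈ S X}))
    rw [List.map_ofFn] at this
    exact this
  rw [Set.mem_prod, h1, h2, ← h, ← h']
  rfl

/-- Quantification over sets: the powerset of the monoid collects the products of all words that
arise by marking the positions anew. -/
theorem recognizedBy_exSet {k : ℕ} {α : MSO} (X : ℕ) (hα : RecognizedBy s k α) :
    RecognizedBy s (2 ^ k) (α.exSet X) := by
  classical
  obtain ⟨M, i₁, i₂, f, acc, hM, h⟩ := hα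
  let _ : Monoid (Set M) := Set.monoid
  refine ⟨Set M, inferInstance, inferInstance,
    fun a P Q => {f a P (Q \ {X}), f a P (insert X Q)}, {E | (E ∩ acc).Nonempty},
    by rw [Fintype.card_set]; exact Nat.pow_le_pow_right (by norm_num) hM, fun u ρ S => ?_⟩
  have key : ∀ T : Set (Fin u.length), wordProd f u ρ (Function.update S X T) =
      (List.ofFn fun l => if l ∈ T then f (u.get l) {x | ρ x = l} (insert X {X | l ∈ S X})
        else f (u.get l) {x | ρ x = l} ({X | l ∈ S X} \ {X})).prod := by
    intro T
    unfold wordProd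
    congr 2
    funext l
    split_ifs with hl
    · congr 1
      ext Y
      by_cases hY : Y = X <;> simp [hY, hl]
    · congr 1
      ext Y
      by_cases hY : Y = X <;> simp [hY, hl]
  simp only [Holds, h, Set.mem_ofPred_eq, Set.Nonempty, Set.mem_inter_iff]
  constructor
  · rintro ⟨T, hT⟩
    refine ⟨_, ?_, hT⟩
    rw [key, wordProd, Set.mem_prod_list_ofFn]
    refine ⟨fun l => ⟨if l ∈ T then _ else _, ?_⟩, rfl⟩
    split_ifs
    · exact Or.inr rfl
    · exact Or.inl rfl
  · rintro ⟨m, hm, hacc⟩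
    rw [wordProd, Set.mem_prod_list_ofFn] at hm
    obtain ⟨t, rfl⟩ := hm
    refine ⟨{l | (t l : M) = f (u.get l) {x | ρ x = l} (insert X {X | l ∈ S X})}, ?_⟩
    rw [key]
    convert hacc using 4 with l
    split_ifs with hl
    · exact hl.symm
    · exact ((t l).2.resolve_right hl).symm

/-- Quantification over positions: as for sets, with a factor that counts the marked positions up
to `2`; the element `ε` of the dual numbers, whose square vanishes, does the counting. -/
theorem recognizedBy_ex {k : ℕ} {α : MSO} (y : ℕ) (hα : RecognizedBy s k α) :
    RecognizedBy s (2 ^ (k * 4)) (α.ex y) := by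
  classical
  obtain ⟨M, i₁, i₂, f, acc, hM, h⟩ := hα
  have hone : (1 : Counter) ≠ ε := fun h => by simpa using congrArg TrivSqZeroExt.snd h
  let _ : Monoid (Set (M × Counter)) := Set.monoid
  refine ⟨Set (M × Counter), inferInstance, inferInstance,
    fun a P Q => {(f a (P \ {y}) Q, 1), (f a (insert y P) Q, ε)},
    {E | ∃ m ∈ acc, (m, ε) ∈ E}, ?_, fun u ρ S => ?_⟩
  · rw [Fintype.card_set, Fintype.card_prod, Counter.card_eq]
    exact Nat.pow_le_pow_right (by norm_num) (Nat.mul_le_mul_right _ hM)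
  have key : ∀ i, wordProd f u (Function.update ρ y i) S =
      (List.ofFn fun l => if l = i then f (u.get l) (insert y {x | ρ x = l}) {X | l ∈ S X}
        else f (u.get l) ({x | ρ x = l} \ {y}) {X | l ∈ S X}).prod := by
    intro i
    unfold wordProd
    congr 2
    funext l
    split_ifs with hl
    · congr 1
      ext z
      by_cases hz : z = y <;> simp [hz, hl]
    · congr 1
      ext z
      by_cases hz : z = y <;> simp [hz, hl, eq_comm]
  have hprod : ∀ {n : ℕ} (t : Fin n → M × Counter), (List.ofFn t).prod =
      ((List.ofFn fun l => (t l).1).prod, (List.ofFn fun l => (t l).2).prod) := by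
    intro n t
    have h1 := map_list_prod (MonoidHom.fst M Counter) (List.ofFn t)
    have h2 := map_list_prod (MonoidHom.snd M Counter) (List.ofFn t)
    rw [List.map_ofFn] at h1 h2
    exact Prod.ext h1 h2
  simp only [Holds, h, Set.mem_ofPred_eq]
  constructor
  · rintro ⟨i, hi⟩
    refine ⟨_, hi, ?_⟩
    rw [key, wordProd, Set.mem_prod_list_ofFn]
    refine ⟨fun l => ⟨if l = i then (f (u.get l) (insert y {x | ρ x = l}) {X | l ∈ S X}, ε)
        else (f (u.get l) ({x | ρ x = l} \ {y}) {X | l ∈ S X}, 1), ?_⟩, ?_⟩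
    · split_ifs
      · exact Or.inr rfl
      · exact Or.inl rfl
    · rw [hprod]
      refine Prod.ext ?_ ?_
      · refine congrArg (fun t => (List.ofFn t).prod) (funext fun l => ?_)
        dsimp only
        split_ifs <;> rfl
      · refine Eq.trans (congrArg (fun t => (List.ofFn t).prod) (funext fun l => ?_))
          ((Counter.prod_ofFn_eq_eps fun l => l = i).mpr ⟨i, fun _ => Iff.rfl⟩)
        dsimp only
        split_ifs <;> rfl
  · rintro ⟨m, hm, hacc⟩
    rw [wordProd, Set.mem_prod_list_ofFn] at hacc
    obtain ⟨t, ht⟩ := hacc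
    rw [hprod, Prod.mk.injEq] at ht
    have ht0 : ∀ l, ((t l : M × Counter).2 = ε ∧
        (t l : M × Counter).1 = f (u.get l) (insert y {x | ρ x = l}) {X | l ∈ S X}) ∨
        ((t l : M × Counter).2 = 1 ∧
        (t l : M × Counter).1 = f (u.get l) ({x | ρ x = l} \ {y}) {X | l ∈ S X}) := by
      intro l
      rcases (t l).2 with h | h
      · exact Or.inr ⟨congrArg Prod.snd h, congrArg Prod.fst h⟩
      · exact Or.inl ⟨congrArg Prod.snd h, congrArg Prod.fst h⟩
    have h2 : ∃ i, ∀ l, (t l : M × Counter).2 = ε ↔ l = i := by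
      rw [← Counter.prod_ofFn_eq_eps]
      refine Eq.trans (congrArg (fun t => (List.ofFn t).prod) (funext fun l => ?_)) ht.2
      rcases ht0 l with h | h
      · rw [if_pos h.1, h.1]
      · rw [if_neg (by rw [h.1]; exact hone), h.1]
    obtain ⟨i, hi⟩ := h2
    refine ⟨i, ?_⟩
    rw [key]
    convert hm using 1
    rw [← ht.1]
    congr 2
    funext l
    split_ifs with hl
    · rcases ht0 l with h | h
      · exact h.2.symm
      · exact absurd (h.1.symm.trans ((hi l).mpr hl)) hone
    · rcases ht0 l with h | h
      · exact absurd ((hi l).mp h.1) hl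
      · exact h.2.symm

/-- Every formula of monadic second-order logic is recognized by a finite monoid whose size is
bounded in terms of the formula. -/
theorem recognizedBy_tower (s : ℕ) (α : MSO) : RecognizedBy s (tower (α.code + 2)) α := by
  induction α with
  | label a x =>
    refine (recognizedBy_of_first (fun P => x ∈ P) (fun c _ _ => (c : ℕ) = a) fun u ρ S =>
      ⟨ρ x, fun l hl h => hl.ne h.symm, rfl, Iff.rfl⟩).mono (four_le_tower _)
  | le x y =>
    refine (recognizedBy_of_first (fun P => x ∈ P ∨ y ∈ P) (fun _ P _ => x ∈ P) fun u ρ S =>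
      ⟨min (ρ x) (ρ y), fun l hl h => ?_, ?_, ?_⟩).mono (four_le_tower _)
    · rcases h with h | h
      · exact (lt_min_iff.mp hl).1.ne h.symm
      · exact (lt_min_iff.mp hl).2.ne h.symm
    · rcases min_choice (ρ x) (ρ y) with h | h
      · exact Or.inl h.symm
      · exact Or.inr h.symm
    · simp only [Holds, Set.mem_ofPred_eq]
      rw [eq_comm, min_eq_left_iff]
  | eq x y =>
    refine (recognizedBy_of_first (fun P => x ∈ P) (fun _ P _ => y ∈ P) fun u ρ S =>
      ⟨ρ x, fun l hl h => hl.ne h.symm, rfl, ?_⟩).mono (four_le_tower _)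
    exact eq_comm
  | mem x X =>
    refine (recognizedBy_of_first (fun P => x ∈ P) (fun _ _ Q => X ∈ Q) fun u ρ S =>
      ⟨ρ x, fun l hl h => hl.ne h.symm, rfl, Iff.rfl⟩).mono (four_le_tower _)
  | neg φ ih =>
    exact (recognizedBy_neg ih).mono (tower_mono (by simp only [code]; omega))
  | and φ ψ ihφ ihψ =>
    have h1 := Nat.left_le_pair φ.code ψ.code
    have h2 := Nat.right_le_pair φ.code ψ.code
    have h3 : φ.code + 2 ≤ Nat.pair φ.code ψ.code + 2 := by omega
    have h4 : ψ.code + 2 ≤ Nat.pair φ.code ψ.code + 2 := by omega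
    refine (recognizedBy_and (ihφ.mono (tower_mono h3)) (ihψ.mono (tower_mono h4))).mono ?_
    have h5 : Nat.pair φ.code ψ.code + 2 + 1 + 1 ≤ (φ.and ψ).code + 2 := by
      simp only [code]; omega
    refine le_trans ?_ (tower_mono h5)
    have h6 := four_mul_le_two_pow (four_le_tower (Nat.pair φ.code ψ.code))
    change _ ≤ 2 ^ 2 ^ tower (Nat.pair φ.code ψ.code + 2)
    generalize tower (Nat.pair φ.code ψ.code + 2) = x at *
    calc x * x ≤ 2 ^ x * 2 ^ x := Nat.mul_le_mul Nat.lt_two_pow_self.le Nat.lt_two_pow_self.le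
      _ = 2 ^ (x + x) := (pow_add _ _ _).symm
      _ ≤ 2 ^ 2 ^ x := Nat.pow_le_pow_right (by norm_num) (by omega)
  | ex x φ ih =>
    have h1 := Nat.right_le_pair x φ.code
    refine (recognizedBy_ex x ih).mono ?_
    have h2 : φ.code + 2 + 1 + 1 ≤ (φ.ex x).code + 2 := by simp only [code]; omega
    refine le_trans ?_ (tower_mono h2)
    rw [tower, tower, mul_comm]
    exact Nat.pow_le_pow_right (by norm_num) (four_mul_le_two_pow (four_le_tower _))
  | exSet X φ ih =>
    have h1 := Nat.right_le_pair X φ.code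
    refine (recognizedBy_exSet X ih).mono ?_
    have h2 : φ.code + 2 + 1 ≤ (φ.exSet X).code + 2 := by simp only [code]; omega
    exact le_trans le_rfl (tower_mono h2)

end MSO

/-! ### Words with two marked positions -/

section MarkProd

variable {A M : Type} [Monoid M]

/-- The product along a word of the values of a letter map that also reads two markings of the
positions. -/
def markProd (f : A → Bool → Bool → M) : List A → (ℕ → Bool) → (ℕ → Bool) → M
  | [], _, _ => 1
  | a :: u, P, Q => f a (P 0) (Q 0) * markProd f u (fun l => P (l + 1)) (fun l => Q (l + 1))

theorem markProd_append (f : A → Bool → Bool → M) (u v : List A) (P Q : ℕ → Bool) :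
    markProd f (u ++ v) P Q =
      markProd f u P Q * markProd f v (fun l => P (l + u.length)) (fun l => Q (l + u.length)) := by
  induction u generalizing P Q with
  | nil => simp [markProd]
  | cons a u ih =>
    rw [List.cons_append, markProd, markProd, ih, mul_assoc]
    simp only [List.length_cons, add_assoc]

theorem markProd_congr (f : A → Bool → Bool → M) {u : List A} {P Q P' Q' : ℕ → Bool}
    (hP : ∀ l < u.length, P l = P' l) (hQ : ∀ l < u.length, Q l = Q' l) :
    markProd f u P Q = markProd f u P' Q' := by
  induction u generalizing P Q P' Q' with
  | nil => rfl
  | cons a u ih =>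
    rw [markProd, markProd, hP 0 (by simp), hQ 0 (by simp),
      ih (fun l hl => hP (l + 1) (by simpa using hl)) (fun l hl => hQ (l + 1) (by simpa using hl))]

theorem prod_ofFn_eq_markProd (f : A → Bool → Bool → M) (u : List A) (P Q : ℕ → Bool) :
    (List.ofFn fun l : Fin u.length => f (u.get l) (P l) (Q l)).prod = markProd f u P Q := by
  induction u generalizing P Q with
  | nil => simp [markProd]
  | cons a u ih =>
    rw [markProd, ← ih]
    simp

end MarkProd

namespace MSO

variable {s : ℕ}

/-- The truth value of a binary predicate at a pair of positions. -/
def Holds₂ (u : List (Fin s)) (α : MSO) (i j : Fin u.length) : Prop :=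
  α.Holds u (fun k => if k = 0 then i else j) (fun _ => ∅)

theorem holds₂_self (u : List (Fin s)) (α : MSO) (i : Fin u.length) :
    α.Holds₂ u i i ↔ α.Holds u (fun _ => i) (fun _ => ∅) := by
  simp only [Holds₂, ite_self]

/-- A single finite monoid of bounded size decides all binary predicates with Gödel number less
than `N`. -/
theorem exists_markProd (s N : ℕ) :
    ∃ (M : Type) (_ : Monoid M) (_ : Fintype M) (f : Fin s → Bool → Bool → M),
      Fintype.card M ≤ tower (N + 2) ^ N ∧
      ∀ (u u' : List (Fin s)) (i j : Fin u.length) (i' j' : Fin u'.length),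
        markProd f u (fun l => l == i) (fun l => l == j) =
          markProd f u' (fun l => l == i') (fun l => l == j') →
        ∀ α : MSO, α.code < N → (α.Holds₂ u i j ↔ α.Holds₂ u' i' j') := by
  choose ofCode hofCode using MSO.exists_code_eq
  choose M mM fM f acc hcard hrec using fun n : Fin N => recognizedBy_tower s (ofCode n)
  refine ⟨∀ n, M n, inferInstance, inferInstance,
    fun a x y n => f n a {k | if k = 0 then x = true else y = true} ∅, ?_, ?_⟩
  · rw [Fintype.card_pi]
    calc ∏ n : Fin N, Fintype.card (M n) ≤ ∏ _n : Fin N, tower (N + 2) :=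
          Finset.prod_le_prod' fun n _ => (hcard n).trans
            (tower_mono (by rw [hofCode]; omega))
      _ = tower (N + 2) ^ N := by simp
  · intro u u' i j i' j' h α hα
    have hα' : ofCode (⟨α.code, hα⟩ : Fin N) = α := MSO.code_injective (hofCode _)
    have key : ∀ (v : List (Fin s)) (p q : Fin v.length), α.Holds₂ v p q ↔
        markProd (fun a x y n => f n a {k | if k = 0 then x = true else y = true} ∅) v
          (fun l => l == p) (fun l => l == q) ⟨α.code, hα⟩ ∈ acc ⟨α.code, hα⟩ := by
      intro v p q
      rw [← prod_ofFn_eq_markProd, Holds₂]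
      conv_lhs => rw [← hα', hrec]
      have := map_list_prod (Pi.evalMonoidHom M ⟨α.code, hα⟩) (List.ofFn fun l : Fin v.length =>
        (fun n => f n (v.get l) {k | if k = 0 then ((l : ℕ) == (p : ℕ)) = true
          else ((l : ℕ) == (q : ℕ)) = true} ∅ : ∀ n, M n))
      rw [List.map_ofFn] at this
      simp only [Pi.evalMonoidHom_apply] at this
      rw [this, wordProd]
      have h2 : ∀ l : Fin v.length, {x | (if x = 0 then p else q) = l} =
          {k : ℕ | if k = 0 then ((l : ℕ) == (p : ℕ)) = true
            else ((l : ℕ) == (q : ℕ)) = true} := by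
        intro l
        ext k
        by_cases hk : k = 0 <;> simp only [hk, if_true, if_false, Set.mem_ofPred_eq, beq_iff_eq,
          Fin.ext_iff] <;> exact eq_comm
      have h3 : ∀ l : Fin v.length, {X : ℕ | l ∈ (∅ : Set (Fin v.length))} = ∅ := by
        intro l; ext; simp
      simp only [h2, h3]
      rfl
    rw [key, key, h]

end MSO

/-! ### A bisimulation between origin graphs -/

namespace OGraph

variable {s g : ℕ}

/-- The origin of an element as an input position. -/
def org (w : OGraph s g) : w.Pos → w.InPos
  | .inl i => i
  | .inr j => w.origin j

/-- The label of an output position; input positions have no output label. -/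
def lab (w : OGraph s g) : w.Pos → Option (Fin g)
  | .inl _ => none
  | .inr j => some (w.output.get j)

/-- The output order, which holds between output positions only. -/
def Ole (w : OGraph s g) (p q : w.Pos) : Prop :=
  ∃ j j', p = .inr j ∧ q = .inr j' ∧ j ≤ j'

theorem originFun_eq (w : OGraph s g) (p : w.Pos) : w.originFun p = .inl (w.org p) := by
  cases p <;> rfl

theorem eq_iff (w : OGraph s g) (p q : w.Pos) :
    p = q ↔ (w.lab p = none ∧ w.lab q = none ∧ w.org p = w.org q) ∨ (w.Ole p q ∧ w.Ole q p) := by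
  rcases p with i | j <;> rcases q with i' | j' <;> simp [lab, org, Ole]
  exact le_antisymm_iff

theorem exists_inr_iff (w : OGraph s g) (p : w.Pos) (b : ℕ) :
    (∃ j, p = .inr j ∧ (w.output.get j : ℕ) = b) ↔ ∃ c, w.lab p = some c ∧ (c : ℕ) = b := by
  rcases p with i | j <;> simp [lab]

theorem exists_inl_iff (w : OGraph s g) (p : w.Pos) (P : w.InPos → Prop) :
    (∃ i, p = .inl i ∧ P i) ↔ w.lab p = none ∧ P (w.org p) := by
  rcases p with i | j <;> simp [lab, org]

end OGraph

namespace Term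

variable {s g : ℕ}

/-- The variable of a term. -/
def root : Term → Bool
  | var v => v
  | origin t => t.root

/-- The term is a variable. -/
def IsVar : Term → Prop
  | var _ => True
  | origin _ => False

theorem org_eval (w : OGraph s g) (ν : Bool → w.Pos) (t : Term) :
    w.org (t.eval w ν) = w.org (ν t.root) := by
  induction t with
  | var v => rfl
  | origin t ih => rw [eval, OGraph.originFun_eq, root, ← ih]; rfl

theorem lab_eval (w : OGraph s g) (ν : Bool → w.Pos) (t : Term) :
    w.lab (t.eval w ν) = open Classical in if t.IsVar then w.lab (ν t.root) else none := by
  cases t with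
  | var v => simp [IsVar, root, eval]
  | origin t => rw [eval, OGraph.originFun_eq, IsVar, if_neg not_false]; rfl

theorem ole_eval (w : OGraph s g) (ν : Bool → w.Pos) (t t' : Term) :
    w.Ole (t.eval w ν) (t'.eval w ν) ↔ t.IsVar ∧ t'.IsVar ∧ w.Ole (ν t.root) (ν t'.root) := by
  cases t with
  | var v =>
    cases t' with
    | var v' => simp [IsVar, root, eval]
    | origin t' => simp [IsVar, eval, OGraph.originFun_eq, OGraph.Ole]
  | origin t => simp [IsVar, eval, OGraph.originFun_eq, OGraph.Ole]

end Term

namespace OGraph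

variable {s g : ℕ}

/-- Two elements satisfy the same formulas with Gödel number less than `N` when both variables
are assigned the element. -/
def SameType (N : ℕ) (w : OGraph s g) (p q : w.Pos) : Prop :=
  ∀ φ : LT, φ.code < N → (φ.Holds w (fun _ => p) ↔ φ.Holds w (fun _ => q))

/-- The pairs `(p', q')` and `(p, q)` satisfy the same binary atomic formulas, as far as
predicates with Gödel number less than `N` are concerned. -/
structure SameAtoms (N : ℕ) (w' w : OGraph s g) (p' q' : w'.Pos) (p q : w.Pos) : Prop where
  ole : w'.Ole p' q' ↔ w.Ole p q
  org : w'.org p' = w'.org q' ↔ w.org p = w.org q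
  mso : ∀ α : MSO, α.code < N →
    (α.Holds₂ w'.input (w'.org p') (w'.org q') ↔ α.Holds₂ w.input (w.org p) (w.org q))

/-- The assignments `ν'` into `w'` and `ν` into `w` are indistinguishable at level `N`, when the
type of an element of `w'` is read off from its image under `π`. -/
structure Similar (N : ℕ) {w' w : OGraph s g} (π : w'.Pos → w.Pos)
    (ν' : Bool → w'.Pos) (ν : Bool → w.Pos) : Prop where
  type : ∀ b, w.SameType N (π (ν' b)) (ν b)
  lab : ∀ b, w'.lab (ν' b) = w.lab (ν b)
  atoms : ∀ b c, SameAtoms N w' w (ν' b) (ν' c) (ν b) (ν c)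

/-- The assignment that maps `v` to `q` and the other variable to `p`. -/
def assign {X : Type} (v : Bool) (p q : X) : Bool → X :=
  Function.update (fun _ => p) v q

theorem update_eq_assign {X : Type} (v : Bool) (ν : Bool → X) (q : X) :
    Function.update ν v q = assign v (ν (!v)) q := by
  funext b
  cases b <;> cases v <;> simp [assign]

theorem Similar.of_pair {N : ℕ} {w' w : OGraph s g} {π : w'.Pos → w.Pos} {p' q' : w'.Pos}
    {p q : w.Pos} (hp : w.SameType N (π p') p) (hq : w.SameType N (π q') q)
    (lp : w'.lab p' = w.lab p) (lq : w'.lab q' = w.lab q)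
    (h₁ : SameAtoms N w' w p' q' p q) (h₂ : SameAtoms N w' w q' p' q p)
    (h₃ : SameAtoms N w' w p' p' p p) (h₄ : SameAtoms N w' w q' q' q q) (v : Bool) :
    Similar N π (assign v p' q') (assign v p q) := by
  refine ⟨fun b => ?_, fun b => ?_, fun b c => ?_⟩
  · cases b <;> cases v <;> simpa [assign]
  · cases b <;> cases v <;> simpa [assign]
  · cases b <;> cases c <;> cases v <;> simpa [assign]

/-- Back-and-forth: if every pair in `w'` has the two-element type of some pair in `w` (`back`),
and every pair in `w` whose first element is in the image of `π` is realized in `w'` (`forth`),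
then similar assignments satisfy the same formulas. -/
theorem Similar.holds_iff {N : ℕ} {w' w : OGraph s g} {π : w'.Pos → w.Pos}
    (first : ∀ α : MSO, α.code < N →
      (α.Holds₂ w'.input w'.firstPos w'.firstPos ↔ α.Holds₂ w.input w.firstPos w.firstPos))
    (forth : ∀ v p' q, ∃ q', Similar N π (assign v p' q') (assign v (π p') q))
    (back : ∀ v p' q', ∃ p q, Similar N π (assign v p' q') (assign v p q))
    (φ : LT) (hφ : φ.code < N) {ν' : Bool → w'.Pos} {ν : Bool → w.Pos} (h : Similar N π ν' ν) :
    φ.Holds w' ν' ↔ φ.Holds w ν := by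
  induction φ generalizing ν' ν with
  | label b t =>
    simp only [LT.Holds, exists_inr_iff, Term.lab_eval, h.lab]
  | le t t' =>
    change w'.Ole (t.eval w' ν') (t'.eval w' ν') ↔ w.Ole (t.eval w ν) (t'.eval w ν)
    simp only [Term.ole_eval, (h.atoms _ _).ole]
  | eq t t' =>
    simp only [LT.Holds, eq_iff, Term.ole_eval, Term.lab_eval, Term.org_eval, h.lab,
      (h.atoms _ _).ole, (h.atoms _ _).org]
  | pred0 α =>
    simp only [LT.Holds, ← MSO.holds₂_self]
    exact first α (by simp only [LT.code] at hφ; omega)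
  | pred1 α t =>
    have h1 := Nat.left_le_pair α.code t.code
    simp only [LT.Holds, ← MSO.holds₂_self, exists_inl_iff, Term.lab_eval, Term.org_eval, h.lab,
      (h.atoms _ _).mso α (by simp only [LT.code] at hφ; omega)]
  | pred2 α t t' =>
    have h1 := Nat.left_le_pair α.code (Nat.pair t.code t'.code)
    change (∃ i i', t.eval w' ν' = .inl i ∧ t'.eval w' ν' = .inl i' ∧ α.Holds₂ w'.input i i') ↔
      ∃ i i', t.eval w ν = .inl i ∧ t'.eval w ν = .inl i' ∧ α.Holds₂ w.input i i'
    simp only [exists_and_left, exists_inl_iff, Term.lab_eval, Term.org_eval, h.lab,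
      (h.atoms _ _).mso α (by simp only [LT.code] at hφ; omega)]
  | neg φ ih =>
    exact not_congr (ih (by simp only [LT.code] at hφ; omega) h)
  | and φ ψ ihφ ihψ =>
    have h1 := Nat.left_le_pair φ.code ψ.code
    have h2 := Nat.right_le_pair φ.code ψ.code
    simp only [LT.code] at hφ
    exact and_congr (ihφ (by omega) h) (ihψ (by omega) h)
  | ex v φ ih =>
    have hφ' : φ.code < N := by cases v <;> simp only [LT.code] at hφ <;> omega
    -- the truth value depends on the element assigned to the other variable only
    have key : ∀ p, (LT.ex v φ).Holds w (fun _ => p) ↔ ∃ q, φ.Holds w (assign v p q) :=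
      fun p => Iff.rfl
    have hν : (LT.ex v φ).Holds w ν ↔ ∃ q, φ.Holds w (assign v (ν (!v)) q) := by
      simp only [LT.Holds, update_eq_assign]
    have hν' : (LT.ex v φ).Holds w' ν' ↔ ∃ q, φ.Holds w' (assign v (ν' (!v)) q) := by
      simp only [LT.Holds, update_eq_assign]
    rw [hν', hν, ← key, ← h.type (!v) _ hφ, key]
    constructor
    · rintro ⟨q', hq'⟩
      obtain ⟨p, q, hpq⟩ := back v (ν' (!v)) q'
      have h1 := (key p).mpr ⟨q, (ih hφ' hpq).mp hq'⟩
      rw [← key]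
      have h2 := hpq.type (!v) _ hφ
      simp only [assign, ne_eq, Bool.not_eq_self, not_false_eq_true, Function.update_of_ne] at h2
      exact h2.mpr h1
    · rintro ⟨q, hq⟩
      obtain ⟨q', h'⟩ := forth v (ν' (!v)) q
      exact ⟨q', (ih hφ' h').mpr hq⟩

end OGraph

namespace OGraph

variable {s g : ℕ}

/-- An auxiliary linear order on all elements that extends the output order. -/
def rank (w : OGraph s g) : w.Pos → ℕ
  | .inl i => i
  | .inr j => w.input.length + j

theorem rank_injective (w : OGraph s g) : Function.Injective w.rank := by
  rintro (i | j) (i' | j') h <;> simp only [rank] at h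
  · exact congrArg Sum.inl (Fin.ext h)
  · have := i.2; omega
  · have := i'.2; omega
  · exact congrArg Sum.inr (Fin.ext (by omega))

theorem ole_iff_rank (w : OGraph s g) (p q : w.Pos) :
    w.Ole p q ↔ w.lab p ≠ none ∧ w.lab q ≠ none ∧ w.rank p ≤ w.rank q := by
  rcases p with i | j <;> rcases q with i' | j' <;> simp [lab, Ole, rank]

/-! ### Rearranging the output of an origin graph -/

theorem exists_equiv_fin {Q K : Type} [Fintype Q] [LinearOrder K] (key : Q → K)
    (hkey : Function.Injective key) :
    ∃ e : Fin (Fintype.card Q) ≃ Q, ∀ i j, i ≤ j ↔ key (e i) ≤ key (e j) :=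
  let _ : LinearOrder Q := LinearOrder.lift' key hkey
  ⟨(monoEquivOfFin Q rfl).toEquiv, fun _ _ => (monoEquivOfFin Q rfl).le_iff_le.symm⟩

/-- An origin graph can be changed by replacing its input word by `u'`, whose positions are mapped
to old ones by `back`, by discarding the output positions outside `keep`, and by reordering the
remaining ones according to `key`. -/
theorem exists_rearrangement (w : OGraph s g) (u' : List (Fin s)) (hu' : u' ≠ []) (back : ℕ → ℕ)
    (hback : ∀ i < u'.length, back i < w.input.length) (keep : w.OutPos → Prop)
    (hkeep : ∀ j, keep j → ∃ i < u'.length, back i = w.origin j)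
    {K : Type} [LinearOrder K] (key : w.Pos → K) (hkey : Function.Injective key) :
    ∃ (w' : OGraph s g) (π : w'.Pos → w.Pos), w'.input = u' ∧
      w'.output.length = Nat.card {j // keep j} ∧
      (∀ p, w'.lab p = w.lab (π p)) ∧
      (∀ p, (w.org (π p) : ℕ) = back (w'.org p)) ∧
      (∀ p q, w'.Ole p q ↔ w.lab (π p) ≠ none ∧ w.lab (π q) ≠ none ∧ key (π p) ≤ key (π q)) ∧
      (∀ i : w.InPos, (∃ k < u'.length, back k = i) → ∃ p, π p = .inl i) ∧
      (∀ j, keep j → ∃ p, π p = .inr j) ∧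
      (∀ p j, π p = .inr j → keep j) ∧
      (back 0 = 0 → π (.inl w'.firstPos) = .inl w.firstPos) := by
  classical
  let D := {j // keep j}
  obtain ⟨e, he⟩ := exists_equiv_fin (fun d : D => key (.inr d.1)) fun d d' h =>
    Subtype.ext (Sum.inr.inj (hkey h))
  choose fwd hfwd hfwd' using hkeep
  let out : List (Fin g) := List.ofFn fun k => w.output.get (e k).1
  have hout : out.length = Fintype.card D := List.length_ofFn
  let w' : OGraph s g := ⟨u', hu', out, fun k =>
    ⟨fwd (e (Fin.cast hout k)).1 (e (Fin.cast hout k)).2, hfwd _ _⟩⟩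
  let π : w'.Pos → w.Pos := fun p => match p with
    | .inl i => .inl ⟨back i, hback i i.2⟩
    | .inr j => .inr (e (Fin.cast hout j)).1
  refine ⟨w', π, rfl, ?_, ?_, ?_, ?_, ?_, ?_, ?_, ?_⟩
  · rw [Nat.card_eq_fintype_card]; exact hout
  · rintro (i | j)
    · rfl
    · simp only [lab, w', out, π, List.get_ofFn]
  · rintro (i | j)
    · rfl
    · exact (hfwd' _ _).symm
  · rintro (i | j) (i' | j')
    · simp [Ole, lab, π]
    · simp [Ole, lab, π]
    · simp [Ole, lab, π]
    · have h := he (Fin.cast hout j) (Fin.cast hout j')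
      simp only [Ole, lab, π, ← h]
      simp
  · rintro i ⟨k, hk, hki⟩
    exact ⟨.inl ⟨k, hk⟩, congrArg Sum.inl (Fin.ext hki)⟩
  · intro j hj
    refine ⟨.inr (Fin.cast hout.symm (e.symm ⟨j, hj⟩)), ?_⟩
    simp [π]
  · rintro (i | j') j h
    · simp [π] at h
    · rw [← Sum.inr.inj h]
      exact (e (Fin.cast hout j')).2
  · intro h
    exact congrArg Sum.inl (Fin.ext h)

/-! ### Bounding the number of output positions with the same origin -/

/-- The set of (Gödel numbers below `N` of) formulas satisfied by an element. -/
def type (N : ℕ) (w : OGraph s g) (p : w.Pos) : Set (Fin N) :=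
  {n | (LT.equivNat.symm n).Holds w (fun _ => p)}

theorem SameType.of_type_eq {N : ℕ} {w : OGraph s g} {p q : w.Pos}
    (h : w.type N p = w.type N q) : w.SameType N p q := by
  intro φ hφ
  have := congrArg (fun A => (⟨φ.code, hφ⟩ : Fin N) ∈ A) h
  have hc : LT.equivNat.symm φ.code = φ := LT.equivNat.symm_apply_apply φ
  simpa [type, hc] using this

/-- The assertion that `w'` and `w` satisfy the same sentences with Gödel number less than `N`. -/
def Equivalent (N : ℕ) (w' w : OGraph s g) : Prop :=
  ∀ φ : LT, φ.code < N →
    (φ.Holds w' (fun _ => .inl w'.firstPos) ↔ φ.Holds w (fun _ => .inl w.firstPos))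

/-- A letter map into a monoid whose products along words with two marked positions determine the
binary predicates with Gödel number less than `N`. -/
def Decides {M : Type} [Monoid M] (N : ℕ) (f : Fin s → Bool → Bool → M) : Prop :=
  ∀ (u u' : List (Fin s)) (i j : Fin u.length) (i' j' : Fin u'.length),
    markProd f u (fun l => l == i) (fun l => l == j) =
      markProd f u' (fun l => l == i') (fun l => l == j') →
    ∀ α : MSO, α.code < N → (α.Holds₂ u i j ↔ α.Holds₂ u' i' j')

/-- The product along the input word with the origins of two elements marked. -/
def pairProd {M : Type} [Monoid M] (f : Fin s → Bool → Bool → M) (w : OGraph s g)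
    (p q : w.Pos) : M :=
  markProd f w.input (fun l => l == (w.org p : ℕ)) (fun l => l == (w.org q : ℕ))

theorem SameAtoms.of_pairProd {M : Type} [Monoid M] {N : ℕ} {f : Fin s → Bool → Bool → M}
    (hf : Decides N f) {w' w : OGraph s g} {p' q' : w'.Pos} {p q : w.Pos}
    (ole : w'.Ole p' q' ↔ w.Ole p q) (org : w'.org p' = w'.org q' ↔ w.org p = w.org q)
    (h : pairProd f w' p' q' = pairProd f w p q) : SameAtoms N w' w p' q' p q :=
  ⟨ole, org, fun α hα => hf _ _ _ _ _ _ h α hα⟩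

theorem assign_self {X : Type} (v : Bool) (p : X) : assign v p p = fun _ => p := by
  funext b
  cases b <;> cases v <;> simp [assign]

/-- Back-and-forth for graphs whose first positions correspond. -/
theorem Equivalent.of_similar {N : ℕ} {w' w : OGraph s g} {π : w'.Pos → w.Pos}
    (first : Similar N π (fun _ => .inl w'.firstPos) (fun _ => .inl w.firstPos))
    (forth : ∀ v p' q, ∃ q', Similar N π (assign v p' q') (assign v (π p') q))
    (back : ∀ v p' q', ∃ p q, Similar N π (assign v p' q') (assign v p q)) :
    Equivalent N w' w := fun φ hφ =>
  Similar.holds_iff (fun α hα => (first.atoms true true).mso α hα) forth back φ hφ first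

/-- Among the output positions with the same origin, type and label it suffices to keep the first
and the last one. -/
theorem exists_equivalent_output_le {M : Type} [Monoid M] {N : ℕ} {f : Fin s → Bool → Bool → M}
    (hf : Decides N f) (w : OGraph s g) :
    ∃ w' : OGraph s g, Equivalent N w' w ∧ w'.input.length = w.input.length ∧
      w'.output.length ≤ w.input.length * (2 ^ N * (g * 2)) := by
  classical
  let cls : w.OutPos → w.InPos × Set (Fin N) × Fin g := fun j =>
    (w.origin j, w.type N (.inr j), w.output.get j)
  let IsTop : w.OutPos → Prop := fun j => ∀ j', cls j' = cls j → j' ≤ j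
  let IsBot : w.OutPos → Prop := fun j => ∀ j', cls j' = cls j → j ≤ j'
  have exists_top : ∀ j, ∃ j', cls j' = cls j ∧ IsTop j' ∧ j ≤ j' := fun j => by
    obtain ⟨m, hm, hm'⟩ := (Finset.univ.filter fun j' => cls j' = cls j).exists_max_image id
      ⟨j, by simp⟩
    simp only [Finset.mem_filter, Finset.mem_univ, true_and, id] at hm hm'
    exact ⟨m, hm, fun j' hj' => hm' j' (hj'.trans hm), hm' j rfl⟩
  have exists_bot : ∀ j, ∃ j', cls j' = cls j ∧ IsBot j' ∧ j' ≤ j := fun j => by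
    obtain ⟨m, hm, hm'⟩ := (Finset.univ.filter fun j' => cls j' = cls j).exists_min_image id
      ⟨j, by simp⟩
    simp only [Finset.mem_filter, Finset.mem_univ, true_and, id] at hm hm'
    exact ⟨m, hm, fun j' hj' => hm' j' (hj'.trans hm), hm' j rfl⟩
  obtain ⟨w', π, hin, hout, hlab, horg, hole, hinl, hinr, hkeep, hfirst⟩ :=
    w.exists_rearrangement w.input w.input_ne_nil id (fun _ h => h) (fun j => IsTop j ∨ IsBot j)
      (fun j _ => ⟨w.origin j, (w.origin j).2, rfl⟩) w.rank w.rank_injective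
  have hole' : ∀ p q, w'.Ole p q ↔ w.Ole (π p) (π q) := by
    intro p q
    rw [hole, ole_iff_rank]
  have hprod : ∀ p' q', pairProd f w' p' q' = pairProd f w (π p') (π q') := by
    intro p' q'
    rw [pairProd, pairProd, horg, horg]
    exact congrArg (fun u => markProd f u _ _) hin
  have horg' : ∀ p' q', w'.org p' = w'.org q' ↔ w.org (π p') = w.org (π q') := by
    intro p' q'
    rw [Fin.ext_iff, Fin.ext_iff, horg, horg]
    rfl
  have self : ∀ v p' q', Similar N π (assign v p' q') (assign v (π p') (π q')) := fun v p' q' =>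
    Similar.of_pair (fun _ _ => Iff.rfl) (fun _ _ => Iff.rfl) (hlab _) (hlab _)
      (.of_pairProd hf (hole' _ _) (horg' _ _) (hprod _ _))
      (.of_pairProd hf (hole' _ _) (horg' _ _) (hprod _ _))
      (.of_pairProd hf (hole' _ _) (horg' _ _) (hprod _ _))
      (.of_pairProd hf (hole' _ _) (horg' _ _) (hprod _ _)) v
  have first := self true (.inl w'.firstPos) (.inl w'.firstPos)
  rw [assign_self, assign_self, hfirst rfl] at first
  refine ⟨w', Equivalent.of_similar first ?_ fun v p' q' => ⟨_, _, self v p' q'⟩, by rw [hin], ?_⟩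
  · intro v p' q
    -- a position that is discarded is replaced by the extremal one in its class that lies on the
    -- same side of `π p'`
    have replace : ∀ j m : w.OutPos, q = .inr j → cls m = cls j → (IsTop m ∨ IsBot m) →
        (w.Ole (π p') (.inr m) ↔ w.Ole (π p') (.inr j)) →
        (w.Ole (.inr m) (π p') ↔ w.Ole (.inr j) (π p')) →
        ∃ q', Similar N π (assign v p' q') (assign v (π p') q) := by
      rintro j m rfl hm hk h1 h2
      obtain ⟨q', hq'⟩ := hinr m hk
      have ho : w.org (.inr m) = w.org (.inr j) := congrArg Prod.fst hm
      have hl : w.lab (.inr m) = w.lab (.inr j) := congrArg some (congrArg (fun c => c.2.2) hm)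
      have ht : w.SameType N (.inr m) (.inr j) := .of_type_eq (congrArg (fun c => c.2.1) hm)
      refine ⟨q', Similar.of_pair (fun _ _ => Iff.rfl) (hq' ▸ ht) (hlab _)
        ((hlab _).trans (hq' ▸ hl)) (.of_pairProd hf ?_ ?_ ?_) (.of_pairProd hf ?_ ?_ ?_)
        (.of_pairProd hf (hole' _ _) (horg' _ _) (hprod _ _)) (.of_pairProd hf ?_ ?_ ?_) v⟩
      · rw [hole', hq', h1]
      · rw [horg', hq', ho]
      · rw [hprod, hq', pairProd, pairProd, ho]
      · rw [hole', hq', h2]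
      · rw [horg', hq', ho]
      · rw [hprod, hq', pairProd, pairProd, ho]
      · rw [hole', hq']; simp [Ole]
      · simp
      · rw [hprod, hq', pairProd, pairProd, ho]
    rcases q with i | j
    · obtain ⟨q', hq'⟩ := hinl i ⟨i, i.2, rfl⟩
      exact ⟨q', hq' ▸ self v p' q'⟩
    · rcases hp : π p' with i' | j'
      · obtain ⟨m, hm, hm', -⟩ := exists_top j
        rw [← hp]
        exact replace j m rfl hm (Or.inl hm') (by simp [hp, Ole]) (by simp [hp, Ole])
      · rw [← hp]
        rcases lt_trichotomy j' j with hlt | rfl | hlt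
        · obtain ⟨m, hm, hm', hjm⟩ := exists_top j
          refine replace j m rfl hm (Or.inl hm') ?_ ?_
          · simp [hp, Ole, hlt.le, hlt.le.trans hjm]
          · simp [hp, Ole, hlt.not_ge, (hlt.trans_le hjm).not_ge]
        · exact ⟨p', hp ▸ self v p' p'⟩
        · obtain ⟨m, hm, hm', hjm⟩ := exists_bot j
          refine replace j m rfl hm (Or.inr hm') ?_ ?_
          · simp [hp, Ole, hlt.not_ge, (hjm.trans_lt hlt).not_ge]
          · simp [hp, Ole, hlt.le, hjm.trans hlt.le]
  · rw [hout]
    let code : {j // IsTop j ∨ IsBot j} → (w.InPos × Set (Fin N) × Fin g) × Bool :=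
      fun d => (cls d.1, decide (IsTop d.1))
    have hcode : Function.Injective code := by
      rintro ⟨j, hj⟩ ⟨j', hj'⟩ h
      have h1 : cls j = cls j' := congrArg Prod.fst h
      have h2 : IsTop j ↔ IsTop j' := by simpa [code] using congrArg Prod.snd h
      apply Subtype.ext
      change j = j'
      by_cases ht : IsTop j
      · exact le_antisymm (h2.mp ht j h1) (ht j' h1.symm)
      · exact le_antisymm ((hj.resolve_left ht) j' h1.symm)
          ((hj'.resolve_left (fun h => ht (h2.mpr h))) j h1)
    calc Nat.card {j // IsTop j ∨ IsBot j}
        ≤ Nat.card ((w.InPos × Set (Fin N) × Fin g) × Bool) :=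
          Nat.card_le_card_of_injective code hcode
      _ = w.input.length * (2 ^ N * (g * 2)) := by
          simp only [Nat.card_eq_fintype_card, Fintype.card_prod, Fintype.card_set,
            Fintype.card_fin, Fintype.card_bool]
          ring

end OGraph

/-! ### Cutting a word in two -/

section Cut

variable {A M : Type} [Monoid M]

/-- Position `p` lies to the left (`σ = false`) or to the right (`σ = true`) of the cut before
position `c`. -/
def OnSide (σ : Bool) (c p : ℕ) : Prop :=
  if σ then c ≤ p else p < c

/-- The product over one side of the cut before position `c`.  Positions `p` and `q` of the whole
word are marked if the flags `a` and `b` say so and if they lie on this side. -/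
def sideProd (f : A → Bool → Bool → M) (u : List A) (σ : Bool) (c : ℕ) (a : Bool) (p : ℕ)
    (b : Bool) (q : ℕ) : M :=
  if σ then markProd f (u.drop c) (fun l => a && l + c == p) (fun l => b && l + c == q)
  else markProd f (u.take c) (fun l => a && l == p) (fun l => b && l == q)

/-- The product of the value `x` of side `σ` with the value `y` of the other side. -/
def join (σ : Bool) (x y : M) : M :=
  if σ then y * x else x * y

theorem onSide_or (c p : ℕ) {σ τ : Bool} (h : σ ≠ τ) : OnSide σ c p ∨ OnSide τ c p := by
  cases σ <;> cases τ <;> simp_all [OnSide, le_or_gt, lt_or_ge]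

theorem OnSide.ne {c p q : ℕ} {σ τ : Bool} (h : σ ≠ τ) (hp : OnSide σ c p) (hq : OnSide τ c q) :
    p ≠ q := by
  cases σ <;> cases τ <;> simp_all [OnSide] <;> omega

theorem sideProd_of_not_left (f : A → Bool → Bool → M) (u : List A) {σ τ : Bool} (h : σ ≠ τ)
    {c p : ℕ} (hp : OnSide τ c p) (a b : Bool) (q : ℕ) :
    sideProd f u σ c a p b q = sideProd f u σ c false 0 b q := by
  cases σ <;> cases τ <;> simp_all only [ne_eq, not_true, OnSide, sideProd, if_true, if_false,
    Bool.false_eq_true, Bool.false_and, reduceCtorEq, not_false_eq_true]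
  · refine markProd_congr f (fun l hl => ?_) fun _ _ => rfl
    rw [List.length_take] at hl
    rw [beq_false_of_ne (by omega), Bool.and_false]
  · refine markProd_congr f (fun l hl => ?_) fun _ _ => rfl
    rw [beq_false_of_ne (by omega), Bool.and_false]

theorem sideProd_of_not_right (f : A → Bool → Bool → M) (u : List A) {σ τ : Bool} (h : σ ≠ τ)
    {c q : ℕ} (hq : OnSide τ c q) (a b : Bool) (p : ℕ) :
    sideProd f u σ c a p b q = sideProd f u σ c a p false 0 := by
  cases σ <;> cases τ <;> simp_all only [ne_eq, not_true, OnSide, sideProd, if_true, if_false,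
    Bool.false_eq_true, Bool.false_and, reduceCtorEq, not_false_eq_true]
  · refine markProd_congr f (fun _ _ => rfl) fun l hl => ?_
    rw [List.length_take] at hl
    rw [beq_false_of_ne (by omega), Bool.and_false]
  · refine markProd_congr f (fun _ _ => rfl) fun l hl => ?_
    rw [beq_false_of_ne (by omega), Bool.and_false]

theorem sideProd_false_left (f : A → Bool → Bool → M) (u : List A) (σ : Bool) (c p q : ℕ)
    (b : Bool) : sideProd f u σ c false p b q = sideProd f u σ c false 0 b q := by
  simp only [sideProd, Bool.false_and]

theorem sideProd_false_right (f : A → Bool → Bool → M) (u : List A) (σ : Bool) (c p q : ℕ)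
    (a : Bool) : sideProd f u σ c a p false q = sideProd f u σ c a p false 0 := by
  simp only [sideProd, Bool.false_and]

theorem markProd_eq_join (f : A → Bool → Bool → M) {u : List A} {σ τ : Bool} (h : σ ≠ τ) {c : ℕ}
    (hc : c ≤ u.length) (p q : ℕ) :
    markProd f u (fun l => l == p) (fun l => l == q) =
      join σ (sideProd f u σ c true p true q) (sideProd f u τ c true p true q) := by
  have key : markProd f u (fun l => l == p) (fun l => l == q) =
      sideProd f u false c true p true q * sideProd f u true c true p true q := by
    conv_lhs => rw [← List.take_append_drop c u, markProd_append, List.length_take_of_le hc]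
    simp [sideProd]
  rw [key]
  cases σ <;> cases τ <;> simp_all [join]

theorem markProd_same_side (f : A → Bool → Bool → M) {u : List A} {σ τ : Bool} (h : σ ≠ τ)
    {c p q : ℕ} (hc : c ≤ u.length) (hp : OnSide σ c p) (hq : OnSide σ c q) :
    markProd f u (fun l => l == p) (fun l => l == q) =
      join σ (sideProd f u σ c true p true q) (sideProd f u τ c false 0 false 0) := by
  rw [markProd_eq_join f h hc, sideProd_of_not_left f u h.symm hp,
    sideProd_of_not_right f u h.symm hq]

theorem markProd_other_side (f : A → Bool → Bool → M) {u : List A} {σ τ : Bool} (h : σ ≠ τ)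
    {c p q : ℕ} (hc : c ≤ u.length) (hp : OnSide σ c p) (hq : OnSide τ c q) :
    markProd f u (fun l => l == p) (fun l => l == q) =
      join σ (sideProd f u σ c true p false 0) (sideProd f u τ c false 0 true q) := by
  rw [markProd_eq_join f h hc, sideProd_of_not_left f u h.symm hp,
    sideProd_of_not_right f u h hq]

/-- The position of `u` that becomes position `i` when the positions from `c` up to `c'` are
removed. -/
def uncut (c c' i : ℕ) : ℕ :=
  if i < c then i else i + (c' - c)

theorem uncut_injective (c c' : ℕ) : Function.Injective (uncut c c') := by
  intro i i' h
  simp only [uncut] at h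
  split_ifs at h <;> omega

theorem onSide_uncut {c c' : ℕ} (h : c ≤ c') (σ : Bool) (i : ℕ) :
    OnSide σ (bif σ then c' else c) (uncut c c' i) ↔ OnSide σ c i := by
  cases σ <;> simp only [OnSide, uncut, cond_true, cond_false, if_true, if_false,
    Bool.false_eq_true] <;> split_ifs <;> omega

theorem sideProd_uncut (f : A → Bool → Bool → M) {u : List A} {c c' : ℕ} (h : c ≤ c')
    (hc' : c' ≤ u.length) (σ a b : Bool) {p q : ℕ} (hp : a = true → OnSide σ c p)
    (hq : b = true → OnSide σ c q) :
    sideProd f (u.take c ++ u.drop c') σ c a p b q =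
      sideProd f u σ (bif σ then c' else c) a (uncut c c' p) b (uncut c c' q) := by
  have hlen : (u.take c).length = c := List.length_take_of_le (h.trans hc')
  have key : ∀ (d : Bool) (i : ℕ), (d = true → OnSide σ c i) →
      if σ then ∀ l, (d && l + c == i) = (d && l + c' == uncut c c' i)
      else ∀ l, (d && l == i) = (d && l == uncut c c' i) := by
    intro d i hd
    cases d
    · simp
    · have := hd rfl
      cases σ
      · simp only [OnSide, Bool.false_eq_true, if_false] at this
        simp [uncut, this]
      · simp only [OnSide, if_true] at this
        simp only [uncut, if_neg (not_lt.mpr this), if_true, Bool.true_and]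
        intro l
        rw [Bool.eq_iff_iff, beq_iff_eq, beq_iff_eq]
        omega
  have h1 := key a p hp
  have h2 := key b q hq
  cases σ
  · simp only [Bool.false_eq_true, if_false] at h1 h2
    simp only [sideProd, Bool.false_eq_true, if_false, cond_false, List.take_left' hlen, h1, h2]
  · simp only [if_true] at h1 h2
    simp only [sideProd, if_true, cond_true, List.drop_left' hlen, h1, h2]

end Cut

namespace OGraph

variable {s g : ℕ} {M : Type} [Monoid M]

/-! ### Landmarks of a cut -/

/-- The classes of elements on one side of a cut. -/
abbrev Cls (N g : ℕ) (M : Type) : Type := Set (Fin N) × Option (Fin g) × (Bool → Bool → M)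

/-- The class of an element on side `σ` of the cut before `c`: its type, its label and the
products over its side with its origin marked in all possible ways.  The classes of two elements
on different sides determine all their relations except the output order. -/
def cls (N : ℕ) (f : Fin s → Bool → Bool → M) (w : OGraph s g) (σ : Bool) (c : ℕ) (p : w.Pos) :
    Cls N g M :=
  (w.type N p, w.lab p, fun a b => sideProd f w.input σ c a (w.org p) b (w.org p))

/-- Names of landmarks: a side of the cut, a class, and whether the last (`true`) or the first
(`false`) element of the class in the order by rank is meant. -/
abbrev Name (N g : ℕ) (M : Type) : Type := Bool × Cls N g M × Bool

/-- The element `p` is the landmark `ν` of the cut before `c`. -/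
def IsLandmark (N : ℕ) (f : Fin s → Bool → Bool → M) (w : OGraph s g) (c : ℕ) (ν : Name N g M)
    (p : w.Pos) : Prop :=
  OnSide ν.1 c (w.org p) ∧ cls N f w ν.1 c p = ν.2.1 ∧
    ∀ q, OnSide ν.1 c (w.org q) → cls N f w ν.1 c q = ν.2.1 →
      if ν.2.2 then w.rank q ≤ w.rank p else w.rank p ≤ w.rank q

section Landmarks

variable {N : ℕ} {f : Fin s → Bool → Bool → M} {w : OGraph s g} {c : ℕ}

theorem IsLandmark.unique {ν : Name N g M} {p q : w.Pos} (hp : IsLandmark N f w c ν p)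
    (hq : IsLandmark N f w c ν q) : p = q := by
  have h1 := hp.2.2 q hq.1 hq.2.1
  have h2 := hq.2.2 p hp.1 hp.2.1
  apply w.rank_injective
  split_ifs at h1 h2 <;> omega

theorem exists_isLandmark_last {σ : Bool} {p : w.Pos} (hp : OnSide σ c (w.org p)) :
    ∃ q, IsLandmark N f w c (σ, cls N f w σ c p, true) q ∧ w.rank p ≤ w.rank q := by
  classical
  obtain ⟨m, hm, hm'⟩ := (Finset.univ.filter fun q => OnSide σ c (w.org q) ∧
    cls N f w σ c q = cls N f w σ c p).exists_max_image w.rank ⟨p, by simp [hp]⟩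
  simp only [Finset.mem_filter, Finset.mem_univ, true_and] at hm hm'
  exact ⟨m, ⟨hm.1, hm.2, fun q h1 h2 => hm' q ⟨h1, h2⟩⟩, hm' p ⟨hp, rfl⟩⟩

theorem exists_isLandmark_first {σ : Bool} {p : w.Pos} (hp : OnSide σ c (w.org p)) :
    ∃ q, IsLandmark N f w c (σ, cls N f w σ c p, false) q ∧ w.rank q ≤ w.rank p := by
  classical
  obtain ⟨m, hm, hm'⟩ := (Finset.univ.filter fun q => OnSide σ c (w.org q) ∧
    cls N f w σ c q = cls N f w σ c p).exists_min_image w.rank ⟨p, by simp [hp]⟩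
  simp only [Finset.mem_filter, Finset.mem_univ, true_and] at hm hm'
  exact ⟨m, ⟨hm.1, hm.2, fun q h1 h2 => hm' q ⟨h1, h2⟩⟩, hm' p ⟨hp, rfl⟩⟩

end Landmarks

variable [Fintype M]

noncomputable instance (N g : ℕ) : Fintype (Name N g M) := by
  classical infer_instance

open Classical in
/-- The height of an element relative to the landmarks of the cut before `c`: the number of
landmarks below it plus the number of landmarks below or equal to it.  So two elements have the
same height only if they are equal or no landmark lies between them or coincides with one of
them. -/
noncomputable def height (N : ℕ) (f : Fin s → Bool → Bool → M) (w : OGraph s g) (c : ℕ)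
    (p : w.Pos) : ℕ :=
  (Finset.univ.filter fun ν => ∃ l, IsLandmark N f w c ν l ∧ w.rank l < w.rank p).card +
    (Finset.univ.filter fun ν => ∃ l, IsLandmark N f w c ν l ∧ w.rank l ≤ w.rank p).card

section Height

variable {N : ℕ} {f : Fin s → Bool → Bool → M} {w : OGraph s g} {c : ℕ}

theorem height_mono {p q : w.Pos} (h : w.rank p ≤ w.rank q) :
    height N f w c p ≤ height N f w c q := by
  classical
  refine add_le_add (Finset.card_le_card fun ν => ?_) (Finset.card_le_card fun ν => ?_) <;>
    simp only [Finset.mem_filter, Finset.mem_univ, true_and]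
  · rintro ⟨l, h1, h2⟩
    exact ⟨l, h1, h2.trans_le h⟩
  · rintro ⟨l, h1, h2⟩
    exact ⟨l, h1, h2.trans h⟩

theorem height_lt_of_landmark_lt {ν : Name N g M} {l p : w.Pos} (hl : IsLandmark N f w c ν l)
    (h : w.rank l < w.rank p) : height N f w c l < height N f w c p := by
  classical
  refine add_lt_add_of_lt_of_le (Finset.card_lt_card ?_) (Finset.card_le_card fun ν => ?_)
  · rw [Finset.ssubset_iff_of_subset]
    · refine ⟨ν, Finset.mem_filter.mpr ⟨Finset.mem_univ _, l, hl, h⟩, ?_⟩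
      simp only [Finset.mem_filter, Finset.mem_univ, true_and]
      rintro ⟨l', h1, h2⟩
      rw [h1.unique hl] at h2
      exact lt_irrefl _ h2
    · intro ν
      simp only [Finset.mem_filter, Finset.mem_univ, true_and]
      rintro ⟨l, h1, h2⟩
      exact ⟨l, h1, h2.trans h⟩
  · simp only [Finset.mem_filter, Finset.mem_univ, true_and]
    rintro ⟨l, h1, h2⟩
    exact ⟨l, h1, h2.trans h.le⟩

theorem height_lt_of_lt_landmark {ν : Name N g M} {l p : w.Pos} (hl : IsLandmark N f w c ν l)
    (h : w.rank p < w.rank l) : height N f w c p < height N f w c l := by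
  classical
  refine add_lt_add_of_le_of_lt (Finset.card_le_card fun ν => ?_) (Finset.card_lt_card ?_)
  · simp only [Finset.mem_filter, Finset.mem_univ, true_and]
    rintro ⟨l, h1, h2⟩
    exact ⟨l, h1, h2.trans h⟩
  · rw [Finset.ssubset_iff_of_subset]
    · refine ⟨ν, Finset.mem_filter.mpr ⟨Finset.mem_univ _, l, hl, le_rfl⟩, ?_⟩
      simp only [Finset.mem_filter, Finset.mem_univ, true_and]
      rintro ⟨l', h1, h2⟩
      rw [h1.unique hl] at h2
      exact lt_irrefl _ (h.trans_le h2)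
    · intro ν
      simp only [Finset.mem_filter, Finset.mem_univ, true_and]
      rintro ⟨l, h1, h2⟩
      exact ⟨l, h1, h2.trans h.le⟩

theorem height_lt (p : w.Pos) :
    height N f w c p < 2 * Fintype.card (Name N g M) + 1 := by
  classical
  rw [Nat.lt_succ_iff, two_mul]
  exact add_le_add (Finset.card_le_univ _) (Finset.card_le_univ _)

end Height

/-- The finite type of profiles of cuts. -/
abbrev Profile (N g : ℕ) (M : Type) [Fintype M] : Type :=
  (Bool → M) × (Name N g M → Option (Fin (2 * Fintype.card (Name N g M) + 1)))

open Classical in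
/-- The profile of a cut: the values of both sides and the heights of all landmarks. -/
noncomputable def profile (N : ℕ) (f : Fin s → Bool → Bool → M) (w : OGraph s g) (c : ℕ) :
    Profile N g M :=
  (fun σ => sideProd f w.input σ c false 0 false 0, fun ν =>
    if h : ∃ l, IsLandmark N f w c ν l then some ⟨height N f w c h.choose, height_lt _⟩ else none)

theorem exists_isLandmark_of_profile_eq {N : ℕ} {f : Fin s → Bool → Bool → M} {w : OGraph s g}
    {c c' : ℕ} (h : profile N f w c = profile N f w c') {ν : Name N g M} {l : w.Pos}
    (hl : IsLandmark N f w c ν l) :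
    ∃ l', IsLandmark N f w c' ν l' ∧ height N f w c l = height N f w c' l' := by
  classical
  have h1 := congrFun (congrArg Prod.snd h) ν
  have hex : ∃ l, IsLandmark N f w c ν l := ⟨l, hl⟩
  simp only [profile, dif_pos hex] at h1
  split_ifs at h1 with hex'
  refine ⟨hex'.choose, hex'.choose_spec, ?_⟩
  rw [← hex.choose_spec.unique hl]
  exact congrArg Fin.val (Option.some.inj h1)

end OGraph

namespace OGraph

/-! ### Counting profiles -/

/-- A bound on the number of profiles. -/
def profileBound (N g m : ℕ) : ℕ :=
  m ^ 2 * (2 * (4 * (2 ^ N * ((g + 1) * m ^ 4))) + 2) ^ (4 * (2 ^ N * ((g + 1) * m ^ 4)))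

noncomputable instance (N g : ℕ) (M : Type) [Fintype M] : Fintype (Profile N g M) := by
  classical infer_instance

theorem card_profile_le {N g m : ℕ} {M : Type} [Fintype M] (hM : Fintype.card M ≤ m) :
    Fintype.card (Profile N g M) ≤ profileBound N g m := by
  classical
  have hname : Fintype.card (Name N g M) = 4 * (2 ^ N * ((g + 1) * Fintype.card M ^ 4)) := by
    rw [← Nat.card_eq_fintype_card]
    simp only [Nat.card_eq_fintype_card, Fintype.card_prod, Fintype.card_bool, Fintype.card_set,
      Fintype.card_fin, Fintype.card_option, Fintype.card_fun]
    ring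
  have hprofile : Fintype.card (Profile N g M) = Fintype.card M ^ 2 *
      (2 * Fintype.card (Name N g M) + 2) ^ Fintype.card (Name N g M) := by
    simp only [Fintype.card_prod, Fintype.card_fun, Fintype.card_bool, Fintype.card_option,
      Fintype.card_fin]
  rw [hprofile, hname, profileBound]
  refine Nat.mul_le_mul (Nat.pow_le_pow_left hM 2) ?_
  refine (Nat.pow_le_pow_left (m := 2 * (4 * (2 ^ N * ((g + 1) * m ^ 4))) + 2) ?_ _).trans
    (Nat.pow_le_pow_right (by omega) ?_)
  · gcongr
  · gcongr

variable {s g : ℕ} {M : Type} [Monoid M] [Fintype M]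

/-! ### Removing the input between two cuts with the same profile -/

theorem assign_not {X : Type} (v : Bool) (p q : X) : assign (!v) q p = assign v p q := by
  funext b
  cases b <;> cases v <;> simp [assign]

/-- The part of the input word between two cuts with the same profile can be removed, together with
the output positions that originate there.  The remaining elements of the left part keep their
heights with respect to the first cut, those of the right part their heights with respect to the
second cut, and the new output order is by height. -/
theorem exists_equivalent_of_profile_eq {N : ℕ} {f : Fin s → Bool → Bool → M} (hf : Decides N f)
    (w : OGraph s g) {c c' : ℕ} (hc : 0 < c) (hcc' : c < c') (hc' : c' ≤ w.input.length)
    (h : profile N f w c = profile N f w c') :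
    ∃ w' : OGraph s g, Equivalent N w' w ∧ w'.input.length < w.input.length := by
  classical
  let cut : Bool → ℕ := fun σ => bif σ then c' else c
  have hcut : ∀ σ, cut σ ≤ w.input.length := by
    intro σ
    cases σ
    · exact hcc'.le.trans hc'
    · exact hc'
  have hprofile : ∀ σ τ, profile N f w (cut σ) = profile N f w (cut τ) := by
    intro σ τ
    cases σ <;> cases τ <;> simp [cut, h]
  have hval : ∀ ρ σ τ, sideProd f w.input ρ (cut σ) false 0 false 0 =
      sideProd f w.input ρ (cut τ) false 0 false 0 := fun ρ σ τ =>
    congrFun (congrArg Prod.fst (hprofile σ τ)) ρ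
  let u' : List (Fin s) := w.input.take c ++ w.input.drop c'
  have hlen : u'.length = c + (w.input.length - c') := by
    simp [u']; omega
  have hu' : u' ≠ [] := by
    rw [← List.length_pos_iff, hlen]; omega
  have hback : ∀ i < u'.length, uncut c c' i < w.input.length := by
    intro i hi
    rw [hlen] at hi
    simp only [uncut]
    split_ifs <;> omega
  have hsurj : ∀ i < w.input.length, i < c ∨ c' ≤ i → ∃ k < u'.length, uncut c c' k = i := by
    rintro i hi (hic | hic)
    · exact ⟨i, by omega, if_pos hic⟩
    · refine ⟨i - (c' - c), by omega, ?_⟩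
      rw [uncut, if_neg (by omega)]
      omega
  let side : w.Pos → Bool := fun p => decide (c ≤ w.org p)
  let hgt : w.Pos → ℕ := fun p => height N f w (cut (side p)) p
  let key : w.Pos → ℕ ×ₗ (Bool ×ₗ ℕ) := fun p => toLex (hgt p, toLex (side p, w.rank p))
  have hkey : Function.Injective key := by
    intro p q hpq
    have h1 := congrArg (fun x => (ofLex (ofLex x).2).2) hpq
    exact w.rank_injective h1
  obtain ⟨w', π, hin, -, hlab, horg, hole, hinl, hinr, hkeep, hfirst⟩ :=
    w.exists_rearrangement u' hu' (uncut c c') hback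
      (fun j => (w.origin j : ℕ) < c ∨ c' ≤ w.origin j)
      (fun j hj => hsurj _ (w.origin j).2 hj) key hkey
  have hpre : ∀ q : w.Pos, (w.org q : ℕ) < c ∨ c' ≤ w.org q → ∃ p, π p = q := by
    rintro (i | j) hq
    · exact hinl i (hsurj _ i.2 hq)
    · exact hinr j hq
  -- both `w'` at the cut before `c` and `w` at the cut of the side of an element agree about sides
  have hside : ∀ p σ, OnSide σ c (w'.org p) ↔ OnSide σ (cut σ) (w.org (π p)) := by
    intro p σ
    rw [horg, onSide_uncut hcc'.le]
  have hside' : ∀ p σ, OnSide σ (cut σ) (w.org p) → side p = σ := by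
    intro p σ hp
    cases σ
    · have h1 : (w.org p : ℕ) < c := by simpa [OnSide, cut] using hp
      simpa [side] using h1
    · have h1 : c' ≤ (w.org p : ℕ) := by simpa [OnSide, cut] using hp
      simp only [side, decide_eq_true_eq]
      omega
  have hpre' : ∀ q σ, OnSide σ (cut σ) (w.org q) → ∃ p, π p = q := by
    intro q σ hq
    apply hpre
    cases σ
    · left; simpa [OnSide, cut] using hq
    · right; simpa [OnSide, cut] using hq
  have hinlen : c ≤ w'.input.length := by rw [hin, hlen]; omega
  have hsideProd : ∀ (σ a b : Bool) (p q : w'.Pos), (a = true → OnSide σ c (w'.org p)) →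
      (b = true → OnSide σ c (w'.org q)) →
      sideProd f w'.input σ c a (w'.org p) b (w'.org q) =
        sideProd f w.input σ (cut σ) a (w.org (π p)) b (w.org (π q)) := by
    intro σ a b p q hp hq
    rw [horg, horg, ← sideProd_uncut f hcc'.le hc' σ a b hp hq]
    exact congrArg (fun u => sideProd f u σ c a (w'.org p) b (w'.org q)) hin
  have hsideProd₀ : ∀ σ, sideProd f w'.input σ c false 0 false 0 =
      sideProd f w.input σ (cut σ) false 0 false 0 := by
    intro σ
    have := hsideProd σ false false (.inl w'.firstPos) (.inl w'.firstPos) (by simp) (by simp)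
    rwa [sideProd_false_left, sideProd_false_right, sideProd_false_left,
      sideProd_false_right] at this
  have horg' : ∀ p q, w'.org p = w'.org q ↔ w.org (π p) = w.org (π q) := by
    intro p q
    rw [Fin.ext_iff, Fin.ext_iff, horg, horg, (uncut_injective c c').eq_iff]
  have hkey_le : ∀ p q, key p ≤ key q ↔
      hgt p < hgt q ∨ hgt p = hgt q ∧ toLex (side p, w.rank p) ≤ toLex (side q, w.rank q) :=
    fun p q => Prod.Lex.toLex_le_toLex
  have hkey_same : ∀ p q, side p = side q → (key p ≤ key q ↔ w.rank p ≤ w.rank q) := by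
    intro p q hpq
    have h1 : ∀ p q, side p = side q → w.rank p ≤ w.rank q → key p ≤ key q := by
      intro p q hpq hr
      rw [hkey_le, Prod.Lex.toLex_le_toLex]
      rcases (height_mono hr : height N f w (cut (side p)) p ≤ _).lt_or_eq with h2 | h2
      · left
        simpa only [hgt, ← hpq] using h2
      · right
        exact ⟨by simpa only [hgt, ← hpq] using h2, Or.inr ⟨hpq, hr⟩⟩
    refine ⟨fun hk => ?_, h1 p q hpq⟩
    by_contra hr
    have h2 := h1 q p hpq.symm (not_le.mp hr).le
    exact hr (by rw [hkey (le_antisymm hk h2)])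
  -- pairs on the same side are copied
  have atoms_same : ∀ {σ} p q, OnSide σ c (w'.org p) → OnSide σ c (w'.org q) →
      SameAtoms N w' w p q (π p) (π q) := by
    intro σ p q hp hq
    have hp' := (hside p σ).mp hp
    have hq' := (hside q σ).mp hq
    have hne : σ ≠ !σ := by simp
    refine .of_pairProd hf ?_ (horg' p q) ?_
    · rw [hole, ole_iff_rank, hkey_same _ _ ((hside' _ _ hp').trans (hside' _ _ hq').symm)]
    · rw [pairProd, pairProd, markProd_same_side f hne hinlen hp hq,
        markProd_same_side f hne (hcut σ) hp' hq', hsideProd₀, hval (!σ) (!σ) σ,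
        hsideProd σ true true p q (fun _ => hp) (fun _ => hq)]
  have similar_same : ∀ {σ} v p q, OnSide σ c (w'.org p) → OnSide σ c (w'.org q) →
      Similar N π (assign v p q) (assign v (π p) (π q)) := fun v p q hp hq =>
    .of_pair (fun _ _ => Iff.rfl) (fun _ _ => Iff.rfl) (hlab _) (hlab _) (atoms_same p q hp hq)
      (atoms_same q p hq hp) (atoms_same p p hp hp) (atoms_same q q hq hq) v
  -- pairs on different sides are determined by their classes and their output order
  have atoms_diag : ∀ {σ τ δ} p' p, σ ≠ τ → OnSide σ c (w'.org p') →
      OnSide σ (cut δ) (w.org p) → cls N f w σ (cut σ) (π p') = cls N f w σ (cut δ) p →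
      SameAtoms N w' w p' p' p p := by
    intro σ τ δ p' p hne hp' hp hcls
    have hl : w.lab (π p') = w.lab p := congrArg (fun x => x.2.1) hcls
    refine .of_pairProd hf ?_ (by simp) ?_
    · rw [hole, ole_iff_rank, hl]
      simp
    · rw [pairProd, pairProd, markProd_same_side f hne hinlen hp' hp',
        markProd_same_side f hne (hcut δ) hp hp, hsideProd₀, hval τ τ δ,
        hsideProd σ true true p' p' (fun _ => hp') (fun _ => hp')]
      exact congrArg (fun x => join σ x _) (congrFun (congrFun (congrArg (fun x => x.2.2) hcls) _) _)
  have atoms_mixed : ∀ {σ τ δ} p' q' p q, σ ≠ τ → OnSide σ c (w'.org p') →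
      OnSide τ c (w'.org q') → OnSide σ (cut δ) (w.org p) → OnSide τ (cut δ) (w.org q) →
      cls N f w σ (cut σ) (π p') = cls N f w σ (cut δ) p →
      cls N f w τ (cut τ) (π q') = cls N f w τ (cut δ) q →
      (key (π p') ≤ key (π q') ↔ w.rank p ≤ w.rank q) → SameAtoms N w' w p' q' p q := by
    intro σ τ δ p' q' p q hne hp' hq' hp hq hcp hcq hk
    have hlp : w.lab (π p') = w.lab p := congrArg (fun x => x.2.1) hcp
    have hlq : w.lab (π q') = w.lab q := congrArg (fun x => x.2.1) hcq
    refine .of_pairProd hf ?_ ?_ ?_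
    · rw [hole, ole_iff_rank, hk, hlp, hlq]
    · rw [Fin.ext_iff, Fin.ext_iff]
      exact iff_of_false (hp'.ne hne hq') (hp.ne hne hq)
    · have h1 : sideProd f w'.input σ c true (w'.org p') false 0 =
          sideProd f w.input σ (cut δ) true (w.org p) false 0 := by
        rw [← sideProd_false_right f _ _ _ _ (w'.org p'), hsideProd σ true false p' p'
          (fun _ => hp') (by simp), ← sideProd_false_right f _ _ (cut δ) _ (w.org p)]
        exact congrFun (congrFun (congrArg (fun x => x.2.2) hcp) true) false
      have h2 : sideProd f w'.input τ c false 0 true (w'.org q') =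
          sideProd f w.input τ (cut δ) false 0 true (w.org q) := by
        rw [← sideProd_false_left f _ _ _ (w'.org q'), hsideProd τ false true q' q'
          (by simp) (fun _ => hq'), ← sideProd_false_left f _ _ (cut δ) (w.org q)]
        exact congrFun (congrFun (congrArg (fun x => x.2.2) hcq) false) true
      rw [pairProd, pairProd, markProd_other_side f hne hinlen hp' hq',
        markProd_other_side f hne (hcut δ) hp hq, h1, h2]
  have similar_mixed : ∀ {σ τ δ} v p' q' p q, σ ≠ τ → OnSide σ c (w'.org p') →
      OnSide τ c (w'.org q') → OnSide σ (cut δ) (w.org p) → OnSide τ (cut δ) (w.org q) →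
      cls N f w σ (cut σ) (π p') = cls N f w σ (cut δ) p →
      cls N f w τ (cut τ) (π q') = cls N f w τ (cut δ) q →
      (w.rank p < w.rank q ↔ key (π p') < key (π q')) →
      Similar N π (assign v p' q') (assign v p q) := by
    intro σ τ δ v p' q' p q hne hp' hq' hp hq hcp hcq hk
    have hne' : w.rank p ≠ w.rank q := fun h =>
      hp.ne hne hq (by rw [w.rank_injective h])
    have hkne : key (π p') ≠ key (π q') := fun h =>
      hp'.ne hne hq' (congrArg Fin.val ((horg' _ _).mpr (by rw [hkey h])))
    refine .of_pair (.of_type_eq (congrArg Prod.fst hcp)) (.of_type_eq (congrArg Prod.fst hcq))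
      ((hlab _).trans (congrArg (fun x => x.2.1) hcp))
      ((hlab _).trans (congrArg (fun x => x.2.1) hcq))
      (atoms_mixed p' q' p q hne hp' hq' hp hq hcp hcq ?_)
      (atoms_mixed q' p' q p hne.symm hq' hp' hq hp hcq hcp ?_)
      (atoms_diag p' p hne hp' hp hcp) (atoms_diag q' q hne.symm hq' hq hcq) v
    · rw [hne'.le_iff_lt, hkne.le_iff_lt, hk]
    · rw [← not_lt, ← not_lt, hk]
  have key_lt : ∀ p q, hgt p < hgt q → key p < key q := fun p q hpq =>
    Prod.Lex.toLex_lt_toLex.mpr (Or.inl hpq)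
  have hgt_eq : ∀ {σ} p, OnSide σ (cut σ) (w.org p) → hgt p = height N f w (cut σ) p := by
    intro σ p hp
    simp only [hgt, hside' p σ hp]
  -- an element on the other side is replaced by a landmark of its class
  have forth_mixed : ∀ {σ τ} v p' q, σ ≠ τ → OnSide σ c (w'.org p') →
      OnSide τ (cut σ) (w.org q) → ∃ q', Similar N π (assign v p' q') (assign v (π p') q) := by
    intro σ τ v p' q hne hp' hq
    have hp := (hside p' σ).mp hp'
    have hpq : w.rank (π p') ≠ w.rank q := fun h => hp.ne hne hq (by rw [w.rank_injective h])
    rcases hpq.lt_or_gt with hlt | hlt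
    · obtain ⟨t, ht, hqt⟩ := exists_isLandmark_last (N := N) (f := f) hq
      obtain ⟨t', ht', hh⟩ := exists_isLandmark_of_profile_eq (hprofile σ τ) ht
      obtain ⟨q', rfl⟩ := hpre' t' τ ht'.1
      refine ⟨q', similar_mixed v p' q' (π p') q hne hp' ((hside q' τ).mpr ht'.1) hp hq rfl
        ht'.2.1 (iff_of_true hlt (key_lt _ _ ?_))⟩
      rw [hgt_eq _ hp, hgt_eq _ ht'.1, ← hh]
      exact height_lt_of_lt_landmark ht (hlt.trans_le hqt)
    · obtain ⟨t, ht, hqt⟩ := exists_isLandmark_first (N := N) (f := f) hq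
      obtain ⟨t', ht', hh⟩ := exists_isLandmark_of_profile_eq (hprofile σ τ) ht
      obtain ⟨q', rfl⟩ := hpre' t' τ ht'.1
      refine ⟨q', similar_mixed v p' q' (π p') q hne hp' ((hside q' τ).mpr ht'.1) hp hq rfl
        ht'.2.1 (iff_of_false hlt.not_gt (key_lt _ _ ?_).not_gt)⟩
      rw [hgt_eq _ hp, hgt_eq _ ht'.1, ← hh]
      exact height_lt_of_landmark_lt ht (hqt.trans_lt hlt)
  -- if `p'` lies below `q'`, so does the first element of the class of `p'` below the last one of
  -- the class of `q'`
  have back_mixed : ∀ {σ τ} v p' q', σ ≠ τ → OnSide σ c (w'.org p') → OnSide τ c (w'.org q') →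
      key (π p') < key (π q') → ∃ p q, Similar N π (assign v p' q') (assign v p q) := by
    intro σ τ v p' q' hne hp' hq' hlt
    have hp := (hside p' σ).mp hp'
    have hq := (hside q' τ).mp hq'
    obtain ⟨b, hb, hbp⟩ := exists_isLandmark_first (N := N) (f := f) hp
    obtain ⟨t', ht', hqt⟩ := exists_isLandmark_last (N := N) (f := f) hq
    obtain ⟨t, ht, hh⟩ := exists_isLandmark_of_profile_eq (hprofile τ σ) ht'
    refine ⟨b, t, similar_mixed v p' q' b t hne hp' hq' hb.1 ht.1 hb.2.1.symm ht.2.1.symm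
      (iff_of_true ?_ hlt)⟩
    have h1 : height N f w (cut σ) b ≤ height N f w (cut σ) t := by
      have h2 : hgt (π p') ≤ hgt (π q') := by
        rcases (hkey_le _ _).mp hlt.le with h | h
        · exact h.le
        · exact h.1.le
      rw [hgt_eq _ hp, hgt_eq _ hq] at h2
      rw [← hh]
      exact (height_mono hbp).trans (h2.trans (height_mono hqt))
    by_contra hbt
    have hbt' : w.rank t ≠ w.rank b := fun h =>
      hb.1.ne hne ht.1 (by rw [w.rank_injective h])
    exact (height_lt_of_lt_landmark hb (lt_of_le_of_ne (not_lt.mp hbt) hbt')).not_ge h1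
  have hfirst' : OnSide false c (w'.org (.inl w'.firstPos)) := by
    simpa [OnSide, org, firstPos] using hc
  have first := similar_same true _ _ hfirst' hfirst'
  rw [assign_self, assign_self, hfirst (by simp [uncut, hc])] at first
  refine ⟨w', Equivalent.of_similar first ?_ ?_, by rw [hin, hlen]; omega⟩
  · intro v p' q
    obtain ⟨σ, hp'⟩ : ∃ σ, OnSide σ c (w'.org p') := by
      rcases onSide_or c (w'.org p') Bool.false_ne_true with h | h <;> exact ⟨_, h⟩
    have hne : σ ≠ !σ := by simp
    rcases onSide_or (cut σ) (w.org q) hne with hq | hq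
    · obtain ⟨q', rfl⟩ := hpre' q σ hq
      exact ⟨q', similar_same v p' q' hp' ((hside q' σ).mpr hq)⟩
    · exact forth_mixed v p' q hne hp' hq
  · intro v p' q'
    obtain ⟨σ, hp'⟩ : ∃ σ, OnSide σ c (w'.org p') := by
      rcases onSide_or c (w'.org p') Bool.false_ne_true with h | h <;> exact ⟨_, h⟩
    have hne : σ ≠ !σ := by simp
    rcases onSide_or c (w'.org q') hne with hq' | hq'
    · exact ⟨_, _, similar_same v p' q' hp' hq'⟩
    · have hkne : key (π p') ≠ key (π q') := fun h =>
        hp'.ne hne hq' (congrArg Fin.val ((horg' _ _).mpr (by rw [hkey h])))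
      rcases hkne.lt_or_gt with hlt | hlt
      · exact back_mixed v p' q' hne hp' hq' hlt
      · obtain ⟨q, p, hsim⟩ := back_mixed (!v) q' p' hne.symm hq' hp' hlt
        rw [assign_not, assign_not] at hsim
        exact ⟨p, q, hsim⟩

/-! ### Small models -/

/-- A bound on the length of the input and of the output word of a smallest model. -/
def sizeBound (N g : ℕ) : ℕ :=
  profileBound N g (tower (N + 2) ^ N) * (2 ^ N * (g * 2) + 1)

/-- Small model property. -/
theorem exists_equivalent_length_le (N : ℕ) (w : OGraph s g) :
    ∃ w' : OGraph s g, Equivalent N w' w ∧ w'.input.length ≤ sizeBound N g ∧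
      w'.output.length ≤ sizeBound N g := by
  obtain ⟨M, _, _, f, hM, hf⟩ := MSO.exists_markProd s N
  have hf' : Decides N f := hf
  set B := profileBound N g (tower (N + 2) ^ N) with hB
  have hshort : ∃ w' : OGraph s g, Equivalent N w' w ∧ w'.input.length ≤ B := by
    induction hn : w.input.length using Nat.strong_induction_on generalizing w with
    | _ n ih =>
      by_cases hle : w.input.length ≤ B
      · exact ⟨w, fun _ _ => Iff.rfl, hle⟩
      · have hcard : Fintype.card (Profile N g M) < Fintype.card (Fin w.input.length) := by
          rw [Fintype.card_fin]
          exact (card_profile_le hM).trans_lt (not_le.mp hle)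
        obtain ⟨c, c', hne, heq⟩ := Fintype.exists_ne_map_eq_of_card_lt
          (fun c : Fin w.input.length => profile N f w (c + 1)) hcard
        wlog hlt : c < c' generalizing c c'
        · exact this c' c hne.symm heq.symm (lt_of_le_of_ne (not_lt.mp hlt) hne.symm)
        obtain ⟨w₁, h₁, hlen⟩ := exists_equivalent_of_profile_eq hf' w (Nat.succ_pos c)
          (Nat.succ_lt_succ hlt) c'.2 heq
        obtain ⟨w₂, h₂, hw₂⟩ := ih _ (hn ▸ hlen) w₁ rfl
        exact ⟨w₂, fun φ hφ => (h₂ φ hφ).trans (h₁ φ hφ), hw₂⟩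
  obtain ⟨w₁, h₁, hw₁⟩ := hshort
  obtain ⟨w₂, h₂, hin, hout⟩ := exists_equivalent_output_le hf' w₁
  refine ⟨w₂, fun φ hφ => (h₂ φ hφ).trans (h₁ φ hφ), ?_, hout.trans ?_⟩
  · rw [hin, sizeBound]
    exact hw₁.trans (Nat.le_mul_of_pos_right _ (Nat.succ_pos _))
  · rw [sizeBound]
    exact Nat.mul_le_mul hw₁ (Nat.le_succ _)

end OGraph

/-! ### Primitive recursion -/

attribute [fun_prop] Primrec PrimrecPred
attribute [fun_prop] Primrec.id Primrec.const Primrec.comp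

section Primrec

variable {α β γ : Type} [Primcodable α] [Primcodable β] [Primcodable γ]

@[fun_prop] theorem primrec_fst {f : α → β × γ} (hf : Primrec f) : Primrec fun a => (f a).1 :=
  Primrec.fst.comp hf

@[fun_prop] theorem primrec_snd {f : α → β × γ} (hf : Primrec f) : Primrec fun a => (f a).2 :=
  Primrec.snd.comp hf

@[fun_prop] theorem primrec_prodMk {f : α → β} {g : α → γ} (hf : Primrec f) (hg : Primrec g) :
    Primrec fun a => (f a, g a) :=
  hf.pair hg

@[fun_prop] theorem primrec_add {f g : α → ℕ} (hf : Primrec f) (hg : Primrec g) :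
    Primrec fun a => f a + g a :=
  Primrec.nat_add.comp hf hg

@[fun_prop] theorem primrec_sub {f g : α → ℕ} (hf : Primrec f) (hg : Primrec g) :
    Primrec fun a => f a - g a :=
  Primrec.nat_sub.comp hf hg

@[fun_prop] theorem primrec_mul {f g : α → ℕ} (hf : Primrec f) (hg : Primrec g) :
    Primrec fun a => f a * g a :=
  Primrec.nat_mul.comp hf hg

@[fun_prop] theorem primrec_div {f g : α → ℕ} (hf : Primrec f) (hg : Primrec g) :
    Primrec fun a => f a / g a :=
  Primrec.nat_div.comp hf hg

@[fun_prop] theorem primrec_mod {f g : α → ℕ} (hf : Primrec f) (hg : Primrec g) :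
    Primrec fun a => f a % g a :=
  Primrec.nat_mod.comp hf hg

@[fun_prop] theorem primrec_pow {f g : α → ℕ} (hf : Primrec f) (hg : Primrec g) :
    Primrec fun a => f a ^ g a := by
  refine (Primrec.nat_rec' (f := g) (g := fun _ => 1) (h := fun a x => x.2 * f a) hg
    (Primrec.const 1) ?_).of_eq fun a => ?_
  · exact (Primrec.nat_mul.comp (Primrec.snd.comp Primrec.snd) (hf.comp Primrec.fst))
  · induction g a with
    | zero => rfl
    | succ n ih => rw [pow_succ, ← ih]

@[fun_prop] theorem primrec_natPair {f g : α → ℕ} (hf : Primrec f) (hg : Primrec g) :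
    Primrec fun a => Nat.pair (f a) (g a) :=
  Primrec₂.natPair.comp hf hg

@[fun_prop] theorem primrec_natUnpair {f : α → ℕ} (hf : Primrec f) :
    Primrec fun a => (f a).unpair :=
  Primrec.unpair.comp hf

@[fun_prop] theorem primrec_length {f : α → List β} (hf : Primrec f) :
    Primrec fun a => (f a).length :=
  Primrec.list_length.comp hf

@[fun_prop] theorem primrecPred_and {p q : α → Prop} (hp : PrimrecPred p) (hq : PrimrecPred q) :
    PrimrecPred fun a => p a ∧ q a :=
  hp.and hq

@[fun_prop] theorem primrecPred_or {p q : α → Prop} (hp : PrimrecPred p) (hq : PrimrecPred q) :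
    PrimrecPred fun a => p a ∨ q a :=
  hp.or hq

@[fun_prop] theorem primrecPred_not {p : α → Prop} (hp : PrimrecPred p) :
    PrimrecPred fun a => ¬ p a :=
  hp.not

@[fun_prop] theorem primrecPred_imp {p q : α → Prop} (hp : PrimrecPred p) (hq : PrimrecPred q) :
    PrimrecPred fun a => p a → q a :=
  (hp.not.or hq).of_eq fun _ => imp_iff_not_or.symm

@[fun_prop] theorem primrecPred_eq {f g : α → ℕ} (hf : Primrec f) (hg : Primrec g) :
    PrimrecPred fun a => f a = g a :=
  Primrec.eq.comp hf hg

@[fun_prop] theorem primrecPred_ne {f g : α → ℕ} (hf : Primrec f) (hg : Primrec g) :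
    PrimrecPred fun a => f a ≠ g a :=
  (Primrec.eq.comp hf hg).not

@[fun_prop] theorem primrecPred_lt {f g : α → ℕ} (hf : Primrec f) (hg : Primrec g) :
    PrimrecPred fun a => f a < g a :=
  Primrec.nat_lt.comp hf hg

@[fun_prop] theorem primrecPred_le {f g : α → ℕ} (hf : Primrec f) (hg : Primrec g) :
    PrimrecPred fun a => f a ≤ g a :=
  Primrec.nat_le.comp hf hg

@[fun_prop] theorem primrec_ite {p : α → Prop} [DecidablePred p] {f g : α → ℕ}
    (hp : PrimrecPred p) (hf : Primrec f) (hg : Primrec g) :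
    Primrec fun a => if p a then f a else g a :=
  Primrec.ite hp hf hg

@[fun_prop] theorem primrecPred_exists_lt {f : α → ℕ} {p : α → ℕ → Prop} (hf : Primrec f)
    (hp : PrimrecPred fun z : α × ℕ => p z.1 z.2) : PrimrecPred fun a => ∃ i, i < f a ∧ p a i := by
  have h := PrimrecRel.exists_mem_list (R := fun (x : ℕ) (a : α) => p a x)
    (PrimrecPred.comp (p := fun z : α × ℕ => p z.1 z.2) hp (Primrec.snd.pair Primrec.fst))
  exact (h.comp (Primrec.list_range.comp hf) Primrec.id).of_eq fun a => by simp

@[fun_prop] theorem primrecPred_forall_lt {f : α → ℕ} {p : α → ℕ → Prop} (hf : Primrec f)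
    (hp : PrimrecPred fun z : α × ℕ => p z.1 z.2) : PrimrecPred fun a => ∀ i, i < f a → p a i := by
  have h := PrimrecRel.forall_mem_list (R := fun (x : ℕ) (a : α) => p a x)
    (PrimrecPred.comp (p := fun z : α × ℕ => p z.1 z.2) hp (Primrec.snd.pair Primrec.fst))
  exact (h.comp (Primrec.list_range.comp hf) Primrec.id).of_eq fun a => by simp

/-- The `k`-th entry of a table of truth values; entries outside the table are false. -/
def Entry (l : List Bool) (k : ℕ) : Prop := l.getD k false = true

@[fun_prop] theorem primrecPred_entry {f : α → List Bool} {g : α → ℕ} (hf : Primrec f)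
    (hg : Primrec g) : PrimrecPred fun a => Entry (f a) (g a) :=
  Primrec.eq.comp ((Primrec.list_getD false).comp hf hg) (Primrec.const true)

/-- Course-of-values recursion for predicates: if the truth value at `n` is a primitive recursive
function of the table of the truth values at all smaller numbers, then the predicate is primitive
recursive. -/
theorem primrecPred_of_table {p : α → ℕ → Prop} {Q : α → List Bool → Prop}
    (hQ : PrimrecPred fun z : α × List Bool => Q z.1 z.2)
    (H : ∀ a l, (∀ k < l.length, Entry l k ↔ p a k) → (Q a l ↔ p a l.length)) :
    PrimrecPred fun z : α × ℕ => p z.1 z.2 := by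
  classical
  have h : Primrec₂ fun a n => decide (p a n) := by
    refine Primrec.nat_strong_rec (g := fun a l => some (decide (Q a l))) _
      (Primrec.option_some.comp (PrimrecPred.decide hQ)) fun a n => ?_
    have h1 := H a ((List.range n).map fun k => decide (p a k)) (fun k hk => by
      simp only [List.length_map, List.length_range] at hk
      simp [Entry, hk])
    simp only [List.length_map, List.length_range] at h1
    simp [h1]
  exact PrimrecPred.of_eq (p := fun z : α × ℕ => p z.1 z.2) ⟨_, h⟩ fun _ => Iff.rfl

end Primrec

/-- The `k`-th digit of `e` in base `B`. -/
def digit (B e k : ℕ) : ℕ := e / B ^ k % B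

@[fun_prop] theorem primrec_digit {α : Type} [Primcodable α] {f g h : α → ℕ} (hf : Primrec f)
    (hg : Primrec g) (hh : Primrec h) : Primrec fun a => digit (f a) (g a) (h a) := by
  unfold digit
  fun_prop

theorem exists_digits {B K : ℕ} {d : ℕ → ℕ} (hd : ∀ k < K, d k < B) :
    ∃ e < B ^ K, ∀ k < K, digit B e k = d k := by
  induction K with
  | zero => exact ⟨0, by simp, by simp⟩
  | succ K ih =>
    obtain ⟨e, he, h⟩ := ih fun k hk => hd k (by omega)
    have hdK := hd K (by omega)
    have hB : 0 < B := by omega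
    refine ⟨d K * B ^ K + e, ?_, fun k hk => ?_⟩
    · rw [pow_succ]
      nlinarith [Nat.mul_le_mul_right (B ^ K) (Nat.succ_le_of_lt hdK)]
    · rcases Nat.lt_succ_iff_lt_or_eq.mp hk with hk | rfl
      · rw [← h k hk, digit, digit]
        have h1 : B ^ K = B ^ k * (B * B ^ (K - k - 1)) := by
          rw [← pow_succ', ← pow_add]; congr 1; omega
        rw [h1, show d K * (B ^ k * (B * B ^ (K - k - 1))) + e =
          e + B ^ k * (B * (d K * B ^ (K - k - 1))) by ring,
          Nat.add_mul_div_left _ _ (pow_pos hB k), Nat.add_mul_mod_self_left]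
      · rw [digit, mul_comm, Nat.mul_add_div (pow_pos hB k), Nat.div_eq_of_lt he, add_zero,
          Nat.mod_eq_of_lt hdK]

/-! ### Model checking for monadic second-order logic -/

namespace MSO

/-- Satisfaction in a word of length `n` with letters `letter 0, …, letter (n - 1)`, where positions
and letters are natural numbers and sets of positions are given by the binary digits of natural
numbers. -/
def HoldsNat (letter : ℕ → ℕ) (n : ℕ) : MSO → (ℕ → ℕ) → (ℕ → ℕ) → Prop
  | label a x, ρ, _ => letter (ρ x) = a
  | le x y, ρ, _ => ρ x ≤ ρ y
  | eq x y, ρ, _ => ρ x = ρ y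
  | mem x X, ρ, S => digit 2 (S X) (ρ x) = 1
  | neg φ, ρ, S => ¬ φ.HoldsNat letter n ρ S
  | and φ ψ, ρ, S => φ.HoldsNat letter n ρ S ∧ ψ.HoldsNat letter n ρ S
  | ex x φ, ρ, S => ∃ i < n, φ.HoldsNat letter n (Function.update ρ x i) S
  | exSet X φ, ρ, S => ∃ P < 2 ^ n, φ.HoldsNat letter n ρ (Function.update S X P)

theorem holds_iff_holdsNat {s : ℕ} {u : List (Fin s)} {letter : ℕ → ℕ}
    (hu : ∀ i : Fin u.length, (u.get i : ℕ) = letter i) (φ : MSO) (ρ : ℕ → Fin u.length)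
    (S : ℕ → Set (Fin u.length)) (S' : ℕ → ℕ)
    (hS : ∀ X (i : Fin u.length), i ∈ S X ↔ digit 2 (S' X) i = 1) :
    φ.Holds u ρ S ↔ φ.HoldsNat letter u.length (fun x => ρ x) S' := by
  induction φ generalizing ρ S S' with
  | label a x => rw [Holds, HoldsNat, hu]
  | le x y => rfl
  | eq x y => exact Fin.ext_iff
  | mem x X => exact hS X _
  | neg φ ih => exact not_congr (ih ρ S S' hS)
  | and φ ψ ihφ ihψ => exact and_congr (ihφ ρ S S' hS) (ihψ ρ S S' hS)
  | ex x φ ih =>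
    have h : ∀ i : Fin u.length, (fun y => ((Function.update ρ x i) y : ℕ)) =
        Function.update (fun y => (ρ y : ℕ)) x i := by
      intro i
      funext y
      by_cases hy : y = x <;> simp [hy]
    simp only [Holds, HoldsNat, ih _ S S' hS, h]
    exact ⟨fun ⟨i, hi⟩ => ⟨i, i.2, hi⟩, fun ⟨i, hin, hi⟩ => ⟨⟨i, hin⟩, hi⟩⟩
  | exSet X φ ih =>
    have h : ∀ (P : Set (Fin u.length)) (m : ℕ),
        (∀ i : Fin u.length, i ∈ P ↔ digit 2 m i = 1) → ∀ Y (i : Fin u.length),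
          i ∈ Function.update S X P Y ↔ digit 2 (Function.update S' X m Y) i = 1 := by
      intro P m hP Y i
      by_cases hY : Y = X
      · subst hY; simpa using hP i
      · simpa [hY] using hS Y i
    simp only [Holds, HoldsNat]
    constructor
    · rintro ⟨P, hP⟩
      classical
      obtain ⟨m, hm, hd⟩ := exists_digits (B := 2) (K := u.length)
        (d := fun k => if ∃ hk : k < u.length, ⟨k, hk⟩ ∈ P then 1 else 0)
        (fun k _ => by split_ifs <;> omega)
      refine ⟨m, hm, (ih ρ _ _ (h P m fun i => ?_)).mp hP⟩
      rw [hd i i.2]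
      simp
    · rintro ⟨m, -, hm⟩
      exact ⟨{i | digit 2 m i = 1}, (ih ρ _ _ (h _ m fun i => Iff.rfl)).mpr hm⟩

/-- A formula with Gödel number less than `C` speaks about variables less than `C` only. -/
theorem holdsNat_congr {letter : ℕ → ℕ} {n C : ℕ} (φ : MSO) (hφ : φ.code < C)
    {ρ ρ' S S' : ℕ → ℕ} (hρ : ∀ k < C, ρ k = ρ' k) (hS : ∀ k < C, S k = S' k) :
    φ.HoldsNat letter n ρ S ↔ φ.HoldsNat letter n ρ' S' := by
  induction φ generalizing ρ ρ' S S' with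
  | label a x =>
    have h2 := Nat.right_le_pair a x
    simp only [code] at hφ
    simp only [HoldsNat, hρ x (by omega)]
  | le x y =>
    have h1 := Nat.left_le_pair x y
    have h2 := Nat.right_le_pair x y
    simp only [code] at hφ
    simp only [HoldsNat, hρ x (by omega), hρ y (by omega)]
  | eq x y =>
    have h1 := Nat.left_le_pair x y
    have h2 := Nat.right_le_pair x y
    simp only [code] at hφ
    simp only [HoldsNat, hρ x (by omega), hρ y (by omega)]
  | mem x y =>
    have h1 := Nat.left_le_pair x y
    have h2 := Nat.right_le_pair x y
    simp only [code] at hφ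
    simp only [HoldsNat, hρ x (by omega), hS y (by omega)]
  | neg φ ih => exact not_congr (ih (by simp only [code] at hφ; omega) hρ hS)
  | and φ ψ ihφ ihψ =>
    have h1 := Nat.left_le_pair φ.code ψ.code
    have h2 := Nat.right_le_pair φ.code ψ.code
    simp only [code] at hφ
    exact and_congr (ihφ (by omega) hρ hS) (ihψ (by omega) hρ hS)
  | ex x φ ih =>
    have h2 := Nat.right_le_pair x φ.code
    simp only [code] at hφ
    simp only [HoldsNat]
    refine exists_congr fun i => and_congr_right fun _ => ih (by omega) (fun k hk => ?_) hS
    by_cases h : k = x <;> simp [h, hρ k hk]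
  | exSet X φ ih =>
    have h2 := Nat.right_le_pair X φ.code
    simp only [code] at hφ
    simp only [HoldsNat]
    refine exists_congr fun i => and_congr_right fun _ => ih (by omega) hρ (fun k hk => ?_)
    by_cases h : k = X <;> simp [h, hS k hk]

/-- The formula with a given Gödel number. -/
noncomputable def ofCode (c : ℕ) : MSO := (exists_code_eq c).choose

theorem code_ofCode (c : ℕ) : (ofCode c).code = c := (exists_code_eq c).choose_spec

theorem ofCode_code (φ : MSO) : ofCode φ.code = φ := code_injective (code_ofCode _)

/-- Satisfaction of the formula with Gödel number `c` in the word of length `n` whose letters are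
the digits of `U` in base `s`, under the assignment whose values are the digits of `e` in base
`2 ^ n`: even digits for first-order and odd ones for second-order variables.  The pair of
`c < C` and `e < (2 ^ n) ^ (2 * C)` is given by the number `c * (2 ^ n) ^ (2 * C) + e`, so that
subformulas come with smaller numbers, whatever the assignment. -/
def Check (a : ℕ × ℕ × ℕ × ℕ) (i : ℕ) : Prop :=
  let (s, n, U, C) := a
  let K := (2 ^ n) ^ (2 * C)
  i / K < C ∧ (ofCode (i / K)).HoldsNat (digit s U) n
    (fun x => digit (2 ^ n) (i % K) (2 * x)) (fun X => digit (2 ^ n) (i % K) (2 * X + 1))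

/-- The truth value of the formula with Gödel number `c`, where `x` and `y` are the components of
the pair coded in `c`, under the assignment `e`, read off from the table `l` of the truth values of
its subformulas. -/
def CheckCases (s n U C : ℕ) (l : List Bool) (K c e x y : ℕ) : Prop :=
  (c % 8 = 0 ∧ digit s U (digit (2 ^ n) e (2 * y)) = x) ∨
  (c % 8 = 1 ∧ digit (2 ^ n) e (2 * x) ≤ digit (2 ^ n) e (2 * y)) ∨
  (c % 8 = 2 ∧ digit (2 ^ n) e (2 * x) = digit (2 ^ n) e (2 * y)) ∨
  (c % 8 = 3 ∧ digit 2 (digit (2 ^ n) e (2 * y + 1)) (digit (2 ^ n) e (2 * x)) = 1) ∨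
  (c % 8 = 4 ∧ ¬ Entry l (c / 8 * K + e)) ∨
  (c % 8 = 5 ∧ Entry l (x * K + e) ∧ Entry l (y * K + e)) ∨
  (c % 8 = 6 ∧ ∃ e', e' < K ∧ (∀ k, k < 2 * C → k ≠ 2 * x →
    digit (2 ^ n) e' k = digit (2 ^ n) e k) ∧ digit (2 ^ n) e' (2 * x) < n ∧
      Entry l (y * K + e')) ∨
  (c % 8 = 7 ∧ ∃ e', e' < K ∧ (∀ k, k < 2 * C → k ≠ 2 * x + 1 →
    digit (2 ^ n) e' k = digit (2 ^ n) e k) ∧ Entry l (y * K + e'))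

theorem primrecPred_check : PrimrecPred fun z : (ℕ × ℕ × ℕ × ℕ) × ℕ => Check z.1 z.2 := by
  refine primrecPred_of_table (Q := fun a l =>
    l.length / (2 ^ a.2.1) ^ (2 * a.2.2.2) < a.2.2.2 ∧
      CheckCases a.1 a.2.1 a.2.2.1 a.2.2.2 l ((2 ^ a.2.1) ^ (2 * a.2.2.2))
        (l.length / (2 ^ a.2.1) ^ (2 * a.2.2.2)) (l.length % (2 ^ a.2.1) ^ (2 * a.2.2.2))
        (l.length / (2 ^ a.2.1) ^ (2 * a.2.2.2) / 8).unpair.1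
        (l.length / (2 ^ a.2.1) ^ (2 * a.2.2.2) / 8).unpair.2)
    (by unfold CheckCases; fun_prop) ?_
  rintro ⟨s, n, U, C⟩ l hl
  simp only [Check] at hl ⊢
  refine and_congr_right fun hC => ?_
  set K := (2 ^ n) ^ (2 * C) with hK
  have hKpos : 0 < K := by positivity
  set c := l.length / K with hc
  set e := l.length % K with he
  have heK : e < K := Nat.mod_lt _ hKpos
  have hlen : l.length = c * K + e := by rw [mul_comm]; exact (Nat.div_add_mod _ _).symm
  have entry : ∀ (φ : MSO) e', φ.code < c → e' < K → (Entry l (φ.code * K + e') ↔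
      φ.HoldsNat (digit s U) n (fun x => digit (2 ^ n) e' (2 * x))
        (fun X => digit (2 ^ n) e' (2 * X + 1))) := by
    intro φ e' hφ he'
    have h1 : φ.code * K + e' < l.length := by
      rw [hlen]
      calc φ.code * K + e' < (φ.code + 1) * K := by rw [add_one_mul]; omega
        _ ≤ c * K := Nat.mul_le_mul_right _ hφ
        _ ≤ c * K + e := Nat.le_add_right _ _
    rw [hl _ h1, mul_comm, Nat.mul_add_div hKpos, Nat.div_eq_of_lt he', add_zero,
      Nat.mul_add_mod, Nat.mod_eq_of_lt he', ofCode_code]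
    exact and_iff_right (hφ.trans hC)
  -- changing one digit of the assignment
  have change : ∀ k₀ d : ℕ, k₀ < 2 * C → d < 2 ^ n →
      ∃ e' < K, (∀ k < 2 * C, k ≠ k₀ → digit (2 ^ n) e' k = digit (2 ^ n) e k) ∧
        digit (2 ^ n) e' k₀ = d := by
    intro k₀ d hk₀ hd
    obtain ⟨e', he', h⟩ := exists_digits (B := 2 ^ n) (K := 2 * C)
      (d := fun k => if k = k₀ then d else digit (2 ^ n) e k) (fun k _ => by
        split_ifs
        · exact hd
        · exact Nat.mod_lt _ (by positivity))
    exact ⟨e', he', fun k hk hne => by rw [h k hk, if_neg hne], by rw [h k₀ hk₀, if_pos rfl]⟩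
  obtain ⟨φ, hφ⟩ : ∃ φ : MSO, φ.code = c := exists_code_eq c
  rw [← hφ] at hC entry ⊢
  rw [ofCode_code]
  clear_value c e K
  clear hl hc he hlen
  cases φ with
  | label a x =>
    have h1 : (label a x).code % 8 = 0 := by simp only [code]; omega
    have h2 : (label a x).code / 8 = Nat.pair a x := by simp only [code]; omega
    simp [CheckCases, HoldsNat, h1, h2]
  | le x y =>
    have h1 : (le x y).code % 8 = 1 := by simp only [code]; omega
    have h2 : (le x y).code / 8 = Nat.pair x y := by simp only [code]; omega
    simp [CheckCases, HoldsNat, h1, h2]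
  | eq x y =>
    have h1 : (eq x y).code % 8 = 2 := by simp only [code]; omega
    have h2 : (eq x y).code / 8 = Nat.pair x y := by simp only [code]; omega
    simp [CheckCases, HoldsNat, h1, h2]
  | mem x X =>
    have h1 : (mem x X).code % 8 = 3 := by simp only [code]; omega
    have h2 : (mem x X).code / 8 = Nat.pair x X := by simp only [code]; omega
    simp [CheckCases, HoldsNat, h1, h2]
  | neg φ =>
    have h1 : (neg φ).code % 8 = 4 := by simp only [code]; omega
    have h2 : (neg φ).code / 8 = φ.code := by simp only [code]; omega
    have h3 : φ.code < (neg φ).code := by simp only [code]; omega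
    simp [CheckCases, HoldsNat, h1, h2, entry φ e h3 heK]
  | and φ ψ =>
    have h1 : (and φ ψ).code % 8 = 5 := by simp only [code]; omega
    have h2 : (and φ ψ).code / 8 = Nat.pair φ.code ψ.code := by simp only [code]; omega
    have h3 := Nat.left_le_pair φ.code ψ.code
    have h4 := Nat.right_le_pair φ.code ψ.code
    have h5 : φ.code < (and φ ψ).code := by simp only [code]; omega
    have h6 : ψ.code < (and φ ψ).code := by simp only [code]; omega
    simp [CheckCases, HoldsNat, h1, h2, entry φ e h5 heK, entry ψ e h6 heK]
  | ex x φ =>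
    have h1 : (ex x φ).code % 8 = 6 := by simp only [code]; omega
    have h2 : (ex x φ).code / 8 = Nat.pair x φ.code := by simp only [code]; omega
    have h3 := Nat.left_le_pair x φ.code
    have h4 := Nat.right_le_pair x φ.code
    have h5 : φ.code < (ex x φ).code := by simp only [code]; omega
    have h6 : x < C := by simp only [code] at hC; omega
    have congr : ∀ e' d, (∀ k < 2 * C, k ≠ 2 * x → digit (2 ^ n) e' k = digit (2 ^ n) e k) →
        digit (2 ^ n) e' (2 * x) = d →
        (φ.HoldsNat (digit s U) n (fun x => digit (2 ^ n) e' (2 * x))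
          (fun X => digit (2 ^ n) e' (2 * X + 1)) ↔
        φ.HoldsNat (digit s U) n (Function.update (fun x => digit (2 ^ n) e (2 * x)) x d)
          (fun X => digit (2 ^ n) e (2 * X + 1))) := by
      rintro e' d h rfl
      refine holdsNat_congr φ (h5.trans hC) (fun k hk => ?_) fun k hk => ?_
      · by_cases hkx : k = x
        · simp [hkx]
        · simp only [ne_eq, hkx, not_false_eq_true, Function.update_of_ne]
          exact h _ (by omega) (by omega)
      · exact h _ (by omega) (by omega)
    simp only [CheckCases, HoldsNat, h1, h2, Nat.unpair_pair]
    norm_num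
    constructor
    · rintro ⟨e', he', h, hn, hentry⟩
      exact ⟨_, hn, (congr e' _ h rfl).mp ((entry φ e' h5 he').mp hentry)⟩
    · rintro ⟨i, hi, hφi⟩
      obtain ⟨e', he', h, hd⟩ := change (2 * x) i (by omega)
        (hi.trans Nat.lt_two_pow_self)
      exact ⟨e', he', h, hd ▸ hi, (entry φ e' h5 he').mpr ((congr e' i h hd).mpr hφi)⟩
  | exSet x φ =>
    have h1 : (exSet x φ).code % 8 = 7 := by simp only [code]; omega
    have h2 : (exSet x φ).code / 8 = Nat.pair x φ.code := by simp only [code]; omega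
    have h3 := Nat.left_le_pair x φ.code
    have h4 := Nat.right_le_pair x φ.code
    have h5 : φ.code < (exSet x φ).code := by simp only [code]; omega
    have h6 : x < C := by simp only [code] at hC; omega
    have congr : ∀ e' d, (∀ k < 2 * C, k ≠ 2 * x + 1 →
        digit (2 ^ n) e' k = digit (2 ^ n) e k) → digit (2 ^ n) e' (2 * x + 1) = d →
        (φ.HoldsNat (digit s U) n (fun x => digit (2 ^ n) e' (2 * x))
          (fun X => digit (2 ^ n) e' (2 * X + 1)) ↔
        φ.HoldsNat (digit s U) n (fun x => digit (2 ^ n) e (2 * x))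
          (Function.update (fun X => digit (2 ^ n) e (2 * X + 1)) x d)) := by
      rintro e' d h rfl
      refine holdsNat_congr φ (h5.trans hC) (fun k hk => ?_) fun k hk => ?_
      · exact h _ (by omega) (by omega)
      · by_cases hkx : k = x
        · simp [hkx]
        · simp only [ne_eq, hkx, not_false_eq_true, Function.update_of_ne]
          exact h _ (by omega) (by omega)
    simp only [CheckCases, HoldsNat, h1, h2, Nat.unpair_pair]
    norm_num
    constructor
    · rintro ⟨e', he', h, hentry⟩
      exact ⟨_, Nat.mod_lt _ (by positivity),
        (congr e' _ h rfl).mp ((entry φ e' h5 he').mp hentry)⟩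
    · rintro ⟨i, hi, hφi⟩
      obtain ⟨e', he', h, hd⟩ := change (2 * x + 1) i (by omega) hi
      exact ⟨e', he', h, (entry φ e' h5 he').mpr ((congr e' i h hd).mpr hφi)⟩

/-- The truth value of the binary predicate with Gödel number `c` at the pair `(i, j)`. -/
def HoldsAt (s n U c i j : ℕ) : Prop :=
  (ofCode c).HoldsNat (digit s U) n (fun k => if k = 0 then i else j) (fun _ => 0)

/-- The same truth value, computed by searching for the code `e` of the assignment that maps `0` to
`i`, all other first-order variables to `j`, and all second-order variables to the empty set. -/
def HoldsAtCheck (s n U c i j : ℕ) : Prop :=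
  ∃ e, e < (2 ^ n) ^ (2 * (c + 1)) ∧
    (∀ k, k < c + 1 → digit (2 ^ n) e (2 * k) = (if k = 0 then i else j) ∧
      digit (2 ^ n) e (2 * k + 1) = 0) ∧
    Check (s, n, U, c + 1) (c * (2 ^ n) ^ (2 * (c + 1)) + e)

theorem holdsAtCheck_iff {s n U c i j : ℕ} (hi : i < n) (hj : j < n) :
    HoldsAtCheck s n U c i j ↔ HoldsAt s n U c i j := by
  have key : ∀ e, e < (2 ^ n) ^ (2 * (c + 1)) →
      (∀ k < c + 1, digit (2 ^ n) e (2 * k) = (if k = 0 then i else j) ∧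
        digit (2 ^ n) e (2 * k + 1) = 0) →
      (Check (s, n, U, c + 1) (c * (2 ^ n) ^ (2 * (c + 1)) + e) ↔ HoldsAt s n U c i j) := by
    intro e he h
    have hpos : 0 < (2 ^ n) ^ (2 * (c + 1)) := by positivity
    simp only [Check]
    rw [mul_comm c, Nat.mul_add_div hpos, Nat.div_eq_of_lt he, add_zero, Nat.mul_add_mod,
      Nat.mod_eq_of_lt he, and_iff_right (Nat.lt_succ_self c)]
    exact holdsNat_congr _ (by rw [code_ofCode]; omega) (fun k hk => (h k hk).1)
      fun k hk => (h k hk).2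
  constructor
  · rintro ⟨e, he, h, hc⟩
    exact (key e he h).mp hc
  · intro h
    have hn : n < 2 ^ n := Nat.lt_two_pow_self
    obtain ⟨e, he, hd⟩ := exists_digits (B := 2 ^ n) (K := 2 * (c + 1))
      (d := fun k => if k % 2 = 1 then 0 else if k = 0 then i else j)
      (fun k _ => by split_ifs <;> omega)
    have hd' : ∀ k < c + 1, digit (2 ^ n) e (2 * k) = (if k = 0 then i else j) ∧
        digit (2 ^ n) e (2 * k + 1) = 0 := by
      intro k hk
      refine ⟨?_, ?_⟩
      · rw [hd _ (by omega), if_neg (by omega)]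
        simp only [mul_eq_zero, OfNat.ofNat_ne_zero, false_or]
      · rw [hd _ (by omega), if_pos (by omega)]
    exact ⟨e, he, hd', (key e he hd').mpr h⟩

@[fun_prop] theorem primrecPred_check_comp {α : Type} [Primcodable α]
    {f : α → ℕ × ℕ × ℕ × ℕ} {g : α → ℕ} (hf : Primrec f) (hg : Primrec g) :
    PrimrecPred fun a => Check (f a) (g a) :=
  primrecPred_check.comp (hf.pair hg)

@[fun_prop] theorem primrecPred_holdsAtCheck {α : Type} [Primcodable α]
    {s n U c i j : α → ℕ} (hs : Primrec s) (hn : Primrec n) (hU : Primrec U) (hc : Primrec c)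
    (hi : Primrec i) (hj : Primrec j) :
    PrimrecPred fun a => HoldsAtCheck (s a) (n a) (U a) (c a) (i a) (j a) := by
  unfold HoldsAtCheck
  fun_prop

end MSO

/-! ### Recognizing the formulas of the logic -/

namespace MSO

theorem primrecPred_mem_freeVars :
    PrimrecPred fun z : ℕ × ℕ => z.1 ∈ (ofCode z.2).freeVars := by
  refine primrecPred_of_table (p := fun x c => x ∈ (ofCode c).freeVars) (Q := fun x l =>
    (l.length % 8 = 0 ∧ x = (l.length / 8).unpair.2) ∨
    (l.length % 8 = 1 ∧ (x = (l.length / 8).unpair.1 ∨ x = (l.length / 8).unpair.2)) ∨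
    (l.length % 8 = 2 ∧ (x = (l.length / 8).unpair.1 ∨ x = (l.length / 8).unpair.2)) ∨
    (l.length % 8 = 3 ∧ x = (l.length / 8).unpair.1) ∨
    (l.length % 8 = 4 ∧ Entry l (l.length / 8)) ∨
    (l.length % 8 = 5 ∧ (Entry l (l.length / 8).unpair.1 ∨ Entry l (l.length / 8).unpair.2)) ∨
    (l.length % 8 = 6 ∧ x ≠ (l.length / 8).unpair.1 ∧ Entry l (l.length / 8).unpair.2) ∨
    (l.length % 8 = 7 ∧ Entry l (l.length / 8).unpair.2)) (by fun_prop) fun x l h => ?_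
  obtain ⟨φ, hφ⟩ := exists_code_eq l.length
  rw [← hφ] at h ⊢
  have h' : ∀ ψ : MSO, ψ.code < φ.code → (Entry l ψ.code ↔ x ∈ ψ.freeVars) := fun ψ hψ => by
    rw [h _ hψ, ofCode_code]
  rw [ofCode_code]
  cases φ with
  | neg φ =>
    have h1 := h' φ (by simp only [code]; omega)
    simp only [code, Nat.mul_add_mod, Nat.mul_add_div (by norm_num : 8 > 0)]
    simp [freeVars, h1]
  | and φ ψ =>
    have h3 := Nat.left_le_pair φ.code ψ.code
    have h4 := Nat.right_le_pair φ.code ψ.code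
    have h1 := h' φ (by simp only [code]; omega)
    have h2 := h' ψ (by simp only [code]; omega)
    simp only [code, Nat.mul_add_mod, Nat.mul_add_div (by norm_num : 8 > 0)]
    simp [freeVars, h1, h2]
  | ex y φ =>
    have h3 := Nat.right_le_pair y φ.code
    have h1 := h' φ (by simp only [code]; omega)
    simp only [code, Nat.mul_add_mod, Nat.mul_add_div (by norm_num : 8 > 0)]
    simp [freeVars, h1]
  | exSet X φ =>
    have h3 := Nat.right_le_pair X φ.code
    have h1 := h' φ (by simp only [code]; omega)
    simp only [code, Nat.mul_add_mod, Nat.mul_add_div (by norm_num : 8 > 0)]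
    simp [freeVars, h1]
  | _ =>
    simp only [code, Nat.mul_add_mod, Nat.mul_add_div (by norm_num : 8 > 0)]
    simp [freeVars]

theorem primrecPred_mem_freeSetVars :
    PrimrecPred fun z : ℕ × ℕ => z.1 ∈ (ofCode z.2).freeSetVars := by
  refine primrecPred_of_table (p := fun x c => x ∈ (ofCode c).freeSetVars) (Q := fun x l =>
    (l.length % 8 = 3 ∧ x = (l.length / 8).unpair.2) ∨
    (l.length % 8 = 4 ∧ Entry l (l.length / 8)) ∨
    (l.length % 8 = 5 ∧ (Entry l (l.length / 8).unpair.1 ∨ Entry l (l.length / 8).unpair.2)) ∨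
    (l.length % 8 = 6 ∧ Entry l (l.length / 8).unpair.2) ∨
    (l.length % 8 = 7 ∧ x ≠ (l.length / 8).unpair.1 ∧ Entry l (l.length / 8).unpair.2))
    (by fun_prop) fun x l h => ?_
  obtain ⟨φ, hφ⟩ := exists_code_eq l.length
  rw [← hφ] at h ⊢
  have h' : ∀ ψ : MSO, ψ.code < φ.code → (Entry l ψ.code ↔ x ∈ ψ.freeSetVars) := fun ψ hψ => by
    rw [h _ hψ, ofCode_code]
  rw [ofCode_code]
  cases φ with
  | neg φ =>
    have h1 := h' φ (by simp only [code]; omega)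
    simp only [code, Nat.mul_add_mod, Nat.mul_add_div (by norm_num : 8 > 0)]
    simp [freeSetVars, h1]
  | and φ ψ =>
    have h3 := Nat.left_le_pair φ.code ψ.code
    have h4 := Nat.right_le_pair φ.code ψ.code
    have h1 := h' φ (by simp only [code]; omega)
    have h2 := h' ψ (by simp only [code]; omega)
    simp only [code, Nat.mul_add_mod, Nat.mul_add_div (by norm_num : 8 > 0)]
    simp [freeSetVars, h1, h2]
  | ex y φ =>
    have h3 := Nat.right_le_pair y φ.code
    have h1 := h' φ (by simp only [code]; omega)
    simp only [code, Nat.mul_add_mod, Nat.mul_add_div (by norm_num : 8 > 0)]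
    simp [freeSetVars, h1]
  | exSet X φ =>
    have h3 := Nat.right_le_pair X φ.code
    have h1 := h' φ (by simp only [code]; omega)
    simp only [code, Nat.mul_add_mod, Nat.mul_add_div (by norm_num : 8 > 0)]
    simp [freeSetVars, h1]
  | _ =>
    simp only [code, Nat.mul_add_mod, Nat.mul_add_div (by norm_num : 8 > 0)]
    simp [freeSetVars]

theorem primrecPred_isOver : PrimrecPred fun z : ℕ × ℕ => (ofCode z.2).IsOver z.1 := by
  refine primrecPred_of_table (p := fun s c => (ofCode c).IsOver s) (Q := fun s l =>
    (l.length % 8 = 0 ∧ (l.length / 8).unpair.1 < s) ∨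
    l.length % 8 = 1 ∨ l.length % 8 = 2 ∨ l.length % 8 = 3 ∨
    (l.length % 8 = 4 ∧ Entry l (l.length / 8)) ∨
    (l.length % 8 = 5 ∧ Entry l (l.length / 8).unpair.1 ∧ Entry l (l.length / 8).unpair.2) ∨
    (l.length % 8 = 6 ∧ Entry l (l.length / 8).unpair.2) ∨
    (l.length % 8 = 7 ∧ Entry l (l.length / 8).unpair.2)) (by fun_prop) fun s l h => ?_
  obtain ⟨φ, hφ⟩ := exists_code_eq l.length
  rw [← hφ] at h ⊢
  have h' : ∀ ψ : MSO, ψ.code < φ.code → (Entry l ψ.code ↔ ψ.IsOver s) := fun ψ hψ => by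
    rw [h _ hψ, ofCode_code]
  rw [ofCode_code]
  cases φ with
  | neg φ =>
    have h1 := h' φ (by simp only [code]; omega)
    simp only [code, Nat.mul_add_mod, Nat.mul_add_div (by norm_num : 8 > 0)]
    simp [IsOver, h1]
  | and φ ψ =>
    have h3 := Nat.left_le_pair φ.code ψ.code
    have h4 := Nat.right_le_pair φ.code ψ.code
    have h1 := h' φ (by simp only [code]; omega)
    have h2 := h' ψ (by simp only [code]; omega)
    simp only [code, Nat.mul_add_mod, Nat.mul_add_div (by norm_num : 8 > 0)]
    simp [IsOver, h1, h2]
  | ex y φ =>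
    have h3 := Nat.right_le_pair y φ.code
    have h1 := h' φ (by simp only [code]; omega)
    simp only [code, Nat.mul_add_mod, Nat.mul_add_div (by norm_num : 8 > 0)]
    simp [IsOver, h1]
  | exSet X φ =>
    have h3 := Nat.right_le_pair X φ.code
    have h1 := h' φ (by simp only [code]; omega)
    simp only [code, Nat.mul_add_mod, Nat.mul_add_div (by norm_num : 8 > 0)]
    simp [IsOver, h1]
  | _ =>
    simp only [code, Nat.mul_add_mod, Nat.mul_add_div (by norm_num : 8 > 0)]
    simp [IsOver]

theorem le_code_of_mem_freeVars {x : ℕ} {φ : MSO} (h : x ∈ φ.freeVars) : x ≤ φ.code := by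
  induction φ with
  | label a y =>
    have h2 := Nat.right_le_pair a y
    simp only [freeVars, Finset.mem_singleton] at h
    simp only [code]; omega
  | le y z =>
    have h1 := Nat.left_le_pair y z
    have h2 := Nat.right_le_pair y z
    simp only [freeVars, Finset.mem_insert, Finset.mem_singleton] at h
    simp only [code]; omega
  | eq y z =>
    have h1 := Nat.left_le_pair y z
    have h2 := Nat.right_le_pair y z
    simp only [freeVars, Finset.mem_insert, Finset.mem_singleton] at h
    simp only [code]; omega
  | mem y X =>
    have h1 := Nat.left_le_pair y X
    simp only [freeVars, Finset.mem_singleton] at h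
    simp only [code]; omega
  | neg φ ih =>
    have := ih h
    simp only [code]; omega
  | and φ ψ ihφ ihψ =>
    have h1 := Nat.left_le_pair φ.code ψ.code
    have h2 := Nat.right_le_pair φ.code ψ.code
    simp only [code]
    rcases Finset.mem_union.mp h with h | h
    · have := ihφ h; omega
    · have := ihψ h; omega
  | ex y φ ih =>
    have h2 := Nat.right_le_pair y φ.code
    have := ih (Finset.mem_of_mem_erase h)
    simp only [code]; omega
  | exSet X φ ih =>
    have h2 := Nat.right_le_pair X φ.code
    have := ih h
    simp only [code]; omega

theorem le_code_of_mem_freeSetVars {X : ℕ} {φ : MSO} (h : X ∈ φ.freeSetVars) : X ≤ φ.code := by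
  induction φ with
  | mem y Y =>
    have h2 := Nat.right_le_pair y Y
    simp only [freeSetVars, Finset.mem_singleton] at h
    simp only [code]; omega
  | neg φ ih =>
    have := ih h
    simp only [code]; omega
  | and φ ψ ihφ ihψ =>
    have h1 := Nat.left_le_pair φ.code ψ.code
    have h2 := Nat.right_le_pair φ.code ψ.code
    simp only [code]
    rcases Finset.mem_union.mp h with h | h
    · have := ihφ h; omega
    · have := ihψ h; omega
  | ex y φ ih =>
    have h2 := Nat.right_le_pair y φ.code
    have := ih h
    simp only [code]; omega
  | exSet Y φ ih =>
    have h2 := Nat.right_le_pair Y φ.code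
    have := ih (Finset.mem_of_mem_erase h)
    simp only [code]; omega
  | _ => simp [freeSetVars] at h

@[fun_prop] theorem primrecPred_isPredicate {α : Type} [Primcodable α] {s n c : α → ℕ}
    (hs : Primrec s) (hn : Primrec n) (hc : Primrec c) :
    PrimrecPred fun a => (ofCode (c a)).IsPredicate (s a) (n a) := by
  have h1 : PrimrecPred fun a => (ofCode (c a)).IsOver (s a) :=
    primrecPred_isOver.comp (hs.pair hc)
  have h2 : PrimrecPred fun z : α × ℕ => z.2 ∈ (ofCode (c z.1)).freeVars :=
    primrecPred_mem_freeVars.comp (Primrec.snd.pair (hc.comp Primrec.fst))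
  have h3 : PrimrecPred fun z : α × ℕ => z.2 ∈ (ofCode (c z.1)).freeSetVars :=
    primrecPred_mem_freeSetVars.comp (Primrec.snd.pair (hc.comp Primrec.fst))
  have h4 : PrimrecPred fun a => (ofCode (c a)).IsOver (s a) ∧
      (∀ x, x < c a + 1 → (x ∈ (ofCode (c a)).freeVars → x < n a)) ∧
      ∀ x, x < c a + 1 → ¬ x ∈ (ofCode (c a)).freeSetVars := by fun_prop
  refine h4.of_eq fun a => and_congr_right fun _ => and_congr ?_ ?_
  · refine ⟨fun h x hx => h x ?_ hx, fun h x _ hx => h x hx⟩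
    have := le_code_of_mem_freeVars hx
    rw [code_ofCode] at this
    omega
  · rw [Finset.eq_empty_iff_forall_notMem]
    refine ⟨fun h x hx => h x ?_ hx, fun h x _ => h x⟩
    have := le_code_of_mem_freeSetVars hx
    rw [code_ofCode] at this
    omega

end MSO

namespace Term

theorem root_eq (t : Term) : t.root.toNat = t.code % 2 := by
  induction t with
  | var v => cases v <;> rfl
  | origin t ih => simp [root, code, ih]

theorem freeVars_eq (t : Term) : t.freeVars = {t.root} := by
  induction t with
  | var v => rfl
  | origin t ih => exact ih

theorem mem_freeVars_iff (v : Bool) (t : Term) : v ∈ t.freeVars ↔ v.toNat = t.code % 2 := by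
  rw [freeVars_eq, Finset.mem_singleton, ← root_eq]
  cases v <;> cases t.root <;> simp

end Term

namespace LT

/-- The formula with a given Gödel number. -/
noncomputable def ofCode (c : ℕ) : LT := equivNat.symm c

theorem ofCode_code (φ : LT) : ofCode φ.code = φ := equivNat.symm_apply_apply φ

@[fun_prop] theorem primrec_toNat {α : Type} [Primcodable α] {f : α → Bool} (hf : Primrec f) :
    Primrec fun a => (f a).toNat :=
  (Primrec.dom_finite Bool.toNat).comp hf

theorem primrecPred_mem_freeVars :
    PrimrecPred fun z : Bool × ℕ => z.1 ∈ (ofCode z.2).freeVars := by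
  refine primrecPred_of_table (p := fun v c => v ∈ (ofCode c).freeVars) (Q := fun v l =>
    (l.length % 10 = 0 ∧ v.toNat = (l.length / 10).unpair.2 % 2) ∨
    (l.length % 10 = 1 ∧ (v.toNat = (l.length / 10).unpair.1 % 2 ∨
      v.toNat = (l.length / 10).unpair.2 % 2)) ∨
    (l.length % 10 = 2 ∧ (v.toNat = (l.length / 10).unpair.1 % 2 ∨
      v.toNat = (l.length / 10).unpair.2 % 2)) ∨
    (l.length % 10 = 4 ∧ v.toNat = (l.length / 10).unpair.2 % 2) ∨
    (l.length % 10 = 5 ∧ (v.toNat = (l.length / 10).unpair.2.unpair.1 % 2 ∨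
      v.toNat = (l.length / 10).unpair.2.unpair.2 % 2)) ∨
    (l.length % 10 = 6 ∧ Entry l (l.length / 10)) ∨
    (l.length % 10 = 7 ∧ (Entry l (l.length / 10).unpair.1 ∨ Entry l (l.length / 10).unpair.2)) ∨
    (l.length % 10 = 8 ∧ v.toNat = 1 ∧ Entry l (l.length / 10)) ∨
    (l.length % 10 = 9 ∧ v.toNat = 0 ∧ Entry l (l.length / 10))) (by fun_prop) fun v l h => ?_
  obtain ⟨φ, hφ⟩ := exists_code_eq l.length
  rw [← hφ] at h ⊢
  have h' : ∀ ψ : LT, ψ.code < φ.code → (Entry l ψ.code ↔ v ∈ ψ.freeVars) := fun ψ hψ => by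
    rw [h _ hψ, ofCode_code]
  rw [ofCode_code]
  cases φ with
  | neg φ =>
    have h1 := h' φ (by simp only [code]; omega)
    simp only [code, Nat.mul_add_mod, Nat.mul_add_div (by norm_num : 10 > 0)]
    simp [freeVars, h1]
  | and φ ψ =>
    have h3 := Nat.left_le_pair φ.code ψ.code
    have h4 := Nat.right_le_pair φ.code ψ.code
    have h1 := h' φ (by simp only [code]; omega)
    have h2 := h' ψ (by simp only [code]; omega)
    simp only [code, Nat.mul_add_mod, Nat.mul_add_div (by norm_num : 10 > 0)]
    simp [freeVars, h1, h2]
  | ex y φ =>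
    cases y
    · have h1 := h' φ (by simp only [code]; omega)
      simp only [code, Nat.mul_add_mod, Nat.mul_add_div (by norm_num : 10 > 0)]
      simp [freeVars, h1]
    · have h1 := h' φ (by simp only [code]; omega)
      simp only [code, Nat.mul_add_mod, Nat.mul_add_div (by norm_num : 10 > 0)]
      simp [freeVars, h1]
  | _ =>
    simp only [code, Nat.mul_add_mod, Nat.mul_add_div (by norm_num : 10 > 0)]
    simp [freeVars, Term.mem_freeVars_iff]

theorem primrecPred_isOver :
    PrimrecPred fun z : (ℕ × ℕ) × ℕ => (ofCode z.2).IsOver z.1.1 z.1.2 := by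
  refine primrecPred_of_table (p := fun (a : ℕ × ℕ) c => (ofCode c).IsOver a.1 a.2)
    (Q := fun (a : ℕ × ℕ) l =>
    (l.length % 10 = 0 ∧ (l.length / 10).unpair.1 < a.2) ∨
    l.length % 10 = 1 ∨ l.length % 10 = 2 ∨
    (l.length % 10 = 3 ∧ (MSO.ofCode (l.length / 10)).IsPredicate a.1 0) ∨
    (l.length % 10 = 4 ∧ (MSO.ofCode (l.length / 10).unpair.1).IsPredicate a.1 1) ∨
    (l.length % 10 = 5 ∧ (MSO.ofCode (l.length / 10).unpair.1).IsPredicate a.1 2) ∨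
    (l.length % 10 = 6 ∧ Entry l (l.length / 10)) ∨
    (l.length % 10 = 7 ∧ Entry l (l.length / 10).unpair.1 ∧ Entry l (l.length / 10).unpair.2) ∨
    (l.length % 10 = 8 ∧ Entry l (l.length / 10)) ∨
    (l.length % 10 = 9 ∧ Entry l (l.length / 10))) (by fun_prop) fun a l h => ?_
  obtain ⟨φ, hφ⟩ := exists_code_eq l.length
  rw [← hφ] at h ⊢
  have h' : ∀ ψ : LT, ψ.code < φ.code → (Entry l ψ.code ↔ ψ.IsOver a.1 a.2) := fun ψ hψ => by
    rw [h _ hψ, ofCode_code]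
  rw [ofCode_code]
  cases φ with
  | neg φ =>
    have h1 := h' φ (by simp only [code]; omega)
    simp only [code, Nat.mul_add_mod, Nat.mul_add_div (by norm_num : 10 > 0)]
    simp [IsOver, h1]
  | and φ ψ =>
    have h3 := Nat.left_le_pair φ.code ψ.code
    have h4 := Nat.right_le_pair φ.code ψ.code
    have h1 := h' φ (by simp only [code]; omega)
    have h2 := h' ψ (by simp only [code]; omega)
    simp only [code, Nat.mul_add_mod, Nat.mul_add_div (by norm_num : 10 > 0)]
    simp [IsOver, h1, h2]
  | ex y φ =>
    cases y
    · have h1 := h' φ (by simp only [code]; omega)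
      simp only [code, Nat.mul_add_mod, Nat.mul_add_div (by norm_num : 10 > 0)]
      simp [IsOver, h1]
    · have h1 := h' φ (by simp only [code]; omega)
      simp only [code, Nat.mul_add_mod, Nat.mul_add_div (by norm_num : 10 > 0)]
      simp [IsOver, h1]
  | _ =>
    simp only [code, Nat.mul_add_mod, Nat.mul_add_div (by norm_num : 10 > 0)]
    simp [IsOver, MSO.ofCode_code]

@[fun_prop] theorem primrecPred_isSentence {α : Type} [Primcodable α] {s g c : α → ℕ}
    (hs : Primrec s) (hg : Primrec g) (hc : Primrec c) :
    PrimrecPred fun a => (ofCode (c a)).IsSentence (s a) (g a) := by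
  have h1 : PrimrecPred fun a => (ofCode (c a)).IsOver (s a) (g a) :=
    primrecPred_isOver.comp ((hs.pair hg).pair hc)
  have h2 : ∀ v : Bool, PrimrecPred fun a => v ∈ (ofCode (c a)).freeVars := fun v =>
    primrecPred_mem_freeVars.comp ((Primrec.const v).pair hc)
  refine (h1.and ((h2 false).not.and (h2 true).not)).of_eq fun a => and_congr_right fun _ => ?_
  rw [Finset.eq_empty_iff_forall_notMem, Bool.forall_bool]

end LT

/-! ### Model checking for `L_T` -/

namespace LT

/-- The value of a term when elements are natural numbers and `org` is the origin function. -/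
def evalNat (org : ℕ → ℕ) (ν : Bool → ℕ) (t : Term) : ℕ :=
  if t.code < 2 then ν t.root else org (ν t.root)

/-- Satisfaction in an origin graph whose elements are given by their ranks: the input positions
are `0, …, n - 1` and the output positions are `n, …, n + m - 1`, with labels `out 0, …,
out (m - 1)`.  The truth values of binary predicates are given by `P`. -/
def HoldsNat (P : ℕ → ℕ → ℕ → Prop) (n m : ℕ) (out org : ℕ → ℕ) : LT → (Bool → ℕ) → Prop
  | label b t, ν => n ≤ evalNat org ν t ∧ out (evalNat org ν t - n) = b
  | le t t', ν => n ≤ evalNat org ν t ∧ n ≤ evalNat org ν t' ∧ evalNat org ν t ≤ evalNat org ν t'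
  | eq t t', ν => evalNat org ν t = evalNat org ν t'
  | pred0 α, _ => P α.code 0 0
  | pred1 α t, ν => evalNat org ν t < n ∧ P α.code (evalNat org ν t) (evalNat org ν t)
  | pred2 α t t', ν => evalNat org ν t < n ∧ evalNat org ν t' < n ∧
      P α.code (evalNat org ν t) (evalNat org ν t')
  | neg φ, ν => ¬ φ.HoldsNat P n m out org ν
  | and φ ψ, ν => φ.HoldsNat P n m out org ν ∧ ψ.HoldsNat P n m out org ν
  | ex v φ, ν => ∃ e < n + m, φ.HoldsNat P n m out org (Function.update ν v e)

end LT

namespace OGraph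

variable {s g : ℕ}

theorem exists_rank_eq_iff (w : OGraph s g) (Q : ℕ → Prop) :
    (∃ p, Q (w.rank p)) ↔ ∃ e < w.input.length + w.output.length, Q e := by
  constructor
  · rintro ⟨i | j, h⟩
    · exact ⟨i, by have := i.2; omega, h⟩
    · exact ⟨w.input.length + j, by have := j.2; omega, h⟩
  · rintro ⟨e, he, h⟩
    by_cases hlt : e < w.input.length
    · exact ⟨.inl ⟨e, hlt⟩, h⟩
    · refine ⟨.inr ⟨e - w.input.length, by omega⟩, ?_⟩
      have : w.input.length + (e - w.input.length) = e := by omega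
      simpa [rank, this] using h

theorem holds_iff_holdsNat (w : OGraph s g) {P : ℕ → ℕ → ℕ → Prop} {out org : ℕ → ℕ}
    (hP : ∀ (α : MSO) (i j : w.InPos), α.Holds₂ w.input i j ↔ P α.code i j)
    (hout : ∀ j : w.OutPos, (w.output.get j : ℕ) = out j)
    (horg : ∀ p, (w.org p : ℕ) = org (w.rank p)) (φ : LT) (ν : Bool → w.Pos) :
    φ.Holds w ν ↔
      φ.HoldsNat P w.input.length w.output.length out org (fun v => w.rank (ν v)) := by
  have eval : ∀ (t : Term) (ν : Bool → w.Pos),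
      LT.evalNat org (fun v => w.rank (ν v)) t = w.rank (t.eval w ν) := by
    intro t ν
    cases t with
    | var v => cases v <;> rfl
    | origin t =>
      rw [LT.evalNat, if_neg (by simp [Term.code]), ← horg, Term.root, ← Term.org_eval,
        Term.eval, originFun_eq]
      rfl
  induction φ generalizing ν with
  | label b t =>
    simp only [LT.Holds, LT.HoldsNat, eval]
    rcases t.eval w ν with i | j
    · simp [rank]
    · simp [rank, ← hout]
  | le t t' =>
    simp only [LT.Holds, LT.HoldsNat, eval]
    rcases t.eval w ν with i | j <;> rcases t'.eval w ν with i' | j' <;> simp [rank]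
  | eq t t' => simp only [LT.Holds, LT.HoldsNat, eval, w.rank_injective.eq_iff]
  | pred0 α =>
    simp only [LT.Holds, LT.HoldsNat, ← MSO.holds₂_self, hP]
    rfl
  | pred1 α t =>
    simp only [LT.Holds, LT.HoldsNat, eval, ← MSO.holds₂_self, hP]
    rcases t.eval w ν with i | j <;> simp [rank]
  | pred2 α t t' =>
    change (∃ i i', t.eval w ν = .inl i ∧ t'.eval w ν = .inl i' ∧ α.Holds₂ w.input i i') ↔ _
    simp only [LT.HoldsNat, eval, hP]
    rcases t.eval w ν with i | j <;> rcases t'.eval w ν with i' | j' <;> simp [rank]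
  | neg φ ih => exact not_congr (ih ν)
  | and φ ψ ihφ ihψ => exact and_congr (ihφ ν) (ihψ ν)
  | ex v φ ih =>
    have h : ∀ p, (fun u => w.rank (Function.update ν v p u)) =
        Function.update (fun u => w.rank (ν u)) v (w.rank p) := by
      intro p
      funext u
      by_cases hu : u = v <;> simp [hu]
    simp only [LT.Holds, LT.HoldsNat, ih, h]
    exact exists_rank_eq_iff w fun e =>
      φ.HoldsNat P _ _ out org (Function.update (fun u => w.rank (ν u)) v e)

end OGraph

namespace LT

/-- The origin function on ranks, when the origins of the `n + j` are the digits of `O`. -/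
def orgNat (n O e : ℕ) : ℕ := if e < n then e else digit n O (e - n)

/-- The value of the term with Gödel number `t` under the assignment of `x` and `y`. -/
def evalCode (n O x y t : ℕ) : ℕ :=
  if t < 2 then (if t % 2 = 1 then y else x) else orgNat n O (if t % 2 = 1 then y else x)

@[fun_prop] theorem primrec_evalCode {α : Type} [Primcodable α] {n O x y t : α → ℕ}
    (hn : Primrec n) (hO : Primrec O) (hx : Primrec x) (hy : Primrec y) (ht : Primrec t) :
    Primrec fun a => evalCode (n a) (O a) (x a) (y a) (t a) := by
  unfold evalCode orgNat
  fun_prop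

/-- The assignment of two variables. -/
def pair (x y : ℕ) : Bool → ℕ := fun v => bif v then y else x

theorem evalNat_pair (n O x y : ℕ) (t : Term) :
    evalNat (orgNat n O) (pair x y) t = evalCode n O x y t.code := by
  have h : pair x y t.root = if t.code % 2 = 1 then y else x := by
    rw [← Term.root_eq]
    cases t.root <;> simp [pair]
  rw [evalNat, evalCode, h]

/-- Satisfaction of the formula with Gödel number `c` in the origin graph whose input letters,
output letters and origins are the digits of `U`, `V` and `O`, under the assignment of `x` and `y`,
where `i = c * (n + m) ^ 2 + x * (n + m) + y`. -/
def Check (a : ℕ × ℕ × ℕ × ℕ × ℕ × ℕ × ℕ) (i : ℕ) : Prop :=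
  let (s, n, U, g, m, V, O) := a
  let L := n + m
  0 < n ∧ (ofCode (i / (L * L))).HoldsNat (MSO.HoldsAt s n U) n m (digit g V) (orgNat n O)
    (pair (i % (L * L) / L) (i % (L * L) % L))

/-- The truth value of the formula with Gödel number `c` under the assignment of `x` and `y`, read
off from the table `l` of the truth values of its subformulas. -/
def CheckCases (s n U g m V O : ℕ) (l : List Bool) (c x y : ℕ) : Prop :=
  (c % 10 = 0 ∧ n ≤ evalCode n O x y (c / 10).unpair.2 ∧
    digit g V (evalCode n O x y (c / 10).unpair.2 - n) = (c / 10).unpair.1) ∨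
  (c % 10 = 1 ∧ n ≤ evalCode n O x y (c / 10).unpair.1 ∧ n ≤ evalCode n O x y (c / 10).unpair.2 ∧
    evalCode n O x y (c / 10).unpair.1 ≤ evalCode n O x y (c / 10).unpair.2) ∨
  (c % 10 = 2 ∧ evalCode n O x y (c / 10).unpair.1 = evalCode n O x y (c / 10).unpair.2) ∨
  (c % 10 = 3 ∧ MSO.HoldsAtCheck s n U (c / 10) 0 0) ∨
  (c % 10 = 4 ∧ evalCode n O x y (c / 10).unpair.2 < n ∧
    MSO.HoldsAtCheck s n U (c / 10).unpair.1 (evalCode n O x y (c / 10).unpair.2)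
      (evalCode n O x y (c / 10).unpair.2)) ∨
  (c % 10 = 5 ∧ evalCode n O x y (c / 10).unpair.2.unpair.1 < n ∧
    evalCode n O x y (c / 10).unpair.2.unpair.2 < n ∧
    MSO.HoldsAtCheck s n U (c / 10).unpair.1 (evalCode n O x y (c / 10).unpair.2.unpair.1)
      (evalCode n O x y (c / 10).unpair.2.unpair.2)) ∨
  (c % 10 = 6 ∧ ¬ Entry l (c / 10 * ((n + m) * (n + m)) + (x * (n + m) + y))) ∨
  (c % 10 = 7 ∧ Entry l ((c / 10).unpair.1 * ((n + m) * (n + m)) + (x * (n + m) + y)) ∧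
    Entry l ((c / 10).unpair.2 * ((n + m) * (n + m)) + (x * (n + m) + y))) ∨
  (c % 10 = 8 ∧ ∃ z, z < n + m ∧
    Entry l (c / 10 * ((n + m) * (n + m)) + (z * (n + m) + y))) ∨
  (c % 10 = 9 ∧ ∃ z, z < n + m ∧
    Entry l (c / 10 * ((n + m) * (n + m)) + (x * (n + m) + z)))

theorem primrecPred_check :
    PrimrecPred fun z : (ℕ × ℕ × ℕ × ℕ × ℕ × ℕ × ℕ) × ℕ => Check z.1 z.2 := by
  refine primrecPred_of_table (Q := fun a l => 0 < a.2.1 ∧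
    CheckCases a.1 a.2.1 a.2.2.1 a.2.2.2.1 a.2.2.2.2.1 a.2.2.2.2.2.1 a.2.2.2.2.2.2 l
      (l.length / ((a.2.1 + a.2.2.2.2.1) * (a.2.1 + a.2.2.2.2.1)))
      (l.length % ((a.2.1 + a.2.2.2.2.1) * (a.2.1 + a.2.2.2.2.1)) / (a.2.1 + a.2.2.2.2.1))
      (l.length % ((a.2.1 + a.2.2.2.2.1) * (a.2.1 + a.2.2.2.2.1)) % (a.2.1 + a.2.2.2.2.1)))
    (by unfold CheckCases; fun_prop) ?_
  rintro ⟨s, n, U, g, m, V, O⟩ l hl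
  simp only [Check] at hl ⊢
  refine and_congr_right fun hn => ?_
  set L := n + m with hL
  have hLpos : 0 < L := by omega
  have hKpos : 0 < L * L := Nat.mul_pos hLpos hLpos
  have hx : l.length % (L * L) / L < L := Nat.div_lt_of_lt_mul (Nat.mod_lt _ hKpos)
  have hy : l.length % (L * L) % L < L := Nat.mod_lt _ hLpos
  have entry : ∀ (φ : LT) x y, φ.code < l.length / (L * L) → x < L → y < L →
      (Entry l (φ.code * (L * L) + (x * L + y)) ↔
        φ.HoldsNat (MSO.HoldsAt s n U) n m (digit g V) (orgNat n O) (pair x y)) := by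
    intro φ x y hφ hx hy
    have h1 : x * L + y < L * L := by
      calc x * L + y < (x + 1) * L := by rw [add_one_mul]; omega
        _ ≤ L * L := Nat.mul_le_mul_right _ hx
    have h2 : φ.code * (L * L) + (x * L + y) < l.length := by
      calc φ.code * (L * L) + (x * L + y) < (φ.code + 1) * (L * L) := by rw [add_one_mul]; omega
        _ ≤ l.length / (L * L) * (L * L) := Nat.mul_le_mul_right _ hφ
        _ ≤ l.length := Nat.div_mul_le_self _ _
    rw [hl _ h2, mul_comm φ.code, Nat.mul_add_div hKpos, Nat.div_eq_of_lt h1, add_zero,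
      Nat.mul_add_mod, Nat.mod_eq_of_lt h1, ofCode_code, mul_comm x, Nat.mul_add_div hLpos,
      Nat.div_eq_of_lt hy, add_zero, Nat.mul_add_mod, Nat.mod_eq_of_lt hy]
    exact and_iff_right hn
  generalize l.length % (L * L) / L = x at *
  generalize l.length % (L * L) % L = y at *
  obtain ⟨φ, hφ⟩ := exists_code_eq (l.length / (L * L))
  rw [← hφ] at entry ⊢
  rw [ofCode_code]
  have update_false : ∀ z, Function.update (pair x y) false z = pair z y := fun z => by
    funext v; cases v <;> simp [pair]
  have update_true : ∀ z, Function.update (pair x y) true z = pair x z := fun z => by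
    funext v; cases v <;> simp [pair]
  have div : ∀ k r, r < 10 → (10 * k + r) / 10 = k := fun k r hr => by omega
  have mod : ∀ k r, r < 10 → (10 * k + r) % 10 = r := fun k r hr => by omega
  have div0 : ∀ k, (10 * k) / 10 = k := fun k => by omega
  have mod0 : ∀ k, (10 * k) % 10 = 0 := fun k => by omega
  unfold CheckCases
  cases φ with
  | label b t =>
    simp only [code, HoldsNat, evalNat_pair, div0, mod0, Nat.unpair_pair]
    simp
  | le t t' =>
    simp only [code, HoldsNat, evalNat_pair, div _ 1 (by norm_num),
      mod _ 1 (by norm_num), ← hL, Nat.unpair_pair]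
    simp
  | eq t t' =>
    simp only [code, HoldsNat, evalNat_pair, div _ 2 (by norm_num),
      mod _ 2 (by norm_num), ← hL, Nat.unpair_pair]
    simp
  | pred0 α =>
    simp only [code, HoldsNat, div _ 3 (by norm_num),
      mod _ 3 (by norm_num), ← hL, MSO.holdsAtCheck_iff hn hn]
    simp
  | pred1 α t =>
    have h : ∀ i, (i < n ∧ MSO.HoldsAtCheck s n U α.code i i) ↔
        i < n ∧ MSO.HoldsAt s n U α.code i i := fun i =>
      and_congr_right fun hi => MSO.holdsAtCheck_iff hi hi
    simp only [code, HoldsNat, evalNat_pair, div _ 4 (by norm_num),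
      mod _ 4 (by norm_num), ← hL, Nat.unpair_pair, h]
    simp
  | pred2 α t t' =>
    have h : ∀ i j, (i < n ∧ j < n ∧ MSO.HoldsAtCheck s n U α.code i j) ↔
        i < n ∧ j < n ∧ MSO.HoldsAt s n U α.code i j := fun i j =>
      and_congr_right fun hi => and_congr_right fun hj => MSO.holdsAtCheck_iff hi hj
    simp only [code, HoldsNat, evalNat_pair, div _ 5 (by norm_num),
      mod _ 5 (by norm_num), ← hL, Nat.unpair_pair, h]
    simp
  | neg φ =>
    have h := entry φ x y (by simp only [code]; omega) hx hy
    simp only [code, HoldsNat, div _ 6 (by norm_num),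
      mod _ 6 (by norm_num), ← hL, h]
    simp
  | and φ ψ =>
    have h1 := Nat.left_le_pair φ.code ψ.code
    have h2 := Nat.right_le_pair φ.code ψ.code
    have h3 := entry φ x y (by simp only [code]; omega) hx hy
    have h4 := entry ψ x y (by simp only [code]; omega) hx hy
    simp only [code, HoldsNat, div _ 7 (by norm_num),
      mod _ 7 (by norm_num), ← hL, Nat.unpair_pair, h3, h4]
    simp
  | ex v φ =>
    cases v with
    | false =>
      have h : ∀ z, (z < L ∧ Entry l (φ.code * (L * L) + (z * L + y))) ↔ z < L ∧
          φ.HoldsNat (MSO.HoldsAt s n U) n m (digit g V) (orgNat n O) (pair z y) := fun z =>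
        and_congr_right fun hz => entry φ z y (by simp only [code]; omega) hz hy
      simp only [code, HoldsNat, div _ 8 (by norm_num),
      mod _ 8 (by norm_num), ← hL, h, update_false]
      simp
    | true =>
      have h : ∀ z, (z < L ∧ Entry l (φ.code * (L * L) + (x * L + z))) ↔ z < L ∧
          φ.HoldsNat (MSO.HoldsAt s n U) n m (digit g V) (orgNat n O) (pair x z) := fun z =>
        and_congr_right fun hz => entry φ x z (by simp only [code]; omega) hx hz
      simp only [code, HoldsNat, div _ 9 (by norm_num),
      mod _ 9 (by norm_num), ← hL, h, update_true]
      simp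

@[fun_prop] theorem primrecPred_check_comp {α : Type} [Primcodable α]
    {f : α → ℕ × ℕ × ℕ × ℕ × ℕ × ℕ × ℕ} {i : α → ℕ} (hf : Primrec f) (hi : Primrec i) :
    PrimrecPred fun a => Check (f a) (i a) :=
  primrecPred_check.comp (hf.pair hi)

/-! ### Deciding satisfiability -/

/-- The numbers `n, U, m, V, O` describe the origin graph `w`. -/
structure Describes {s g : ℕ} (n U m V O : ℕ) (w : OGraph s g) : Prop where
  input_length : w.input.length = n
  input_get : ∀ i : w.InPos, (w.input.get i : ℕ) = digit s U i
  output_length : w.output.length = m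
  output_get : ∀ j : w.OutPos, (w.output.get j : ℕ) = digit g V j
  origin : ∀ j : w.OutPos, (w.origin j : ℕ) = digit n O j

theorem Describes.check_iff {s g n U m V O : ℕ} {w : OGraph s g} (h : Describes n U m V O w)
    (φ : LT) : Check (s, n, U, g, m, V, O) (φ.code * ((n + m) * (n + m))) ↔
      φ.Holds w (fun _ => .inl w.firstPos) := by
  obtain ⟨rfl, hin, rfl, hout, horg⟩ := h
  have hn : 0 < w.input.length := List.length_pos_iff.mpr w.input_ne_nil
  rw [w.holds_iff_holdsNat (P := MSO.HoldsAt s w.input.length U) (out := digit g V)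
    (org := orgNat w.input.length O)]
  · have h0 : pair 0 0 = fun _ => w.rank (.inl w.firstPos) := by
      funext v; cases v <;> rfl
    simp only [Check]
    rw [Nat.mul_div_cancel _ (Nat.mul_pos (by omega) (by omega)), Nat.mul_mod_left,
      Nat.zero_div, Nat.zero_mod, ofCode_code, ← h0]
    exact and_iff_right hn
  · intro α i j
    rw [MSO.HoldsAt, MSO.Holds₂, MSO.ofCode_code,
      MSO.holds_iff_holdsNat (letter := digit s U) hin α _ _ (fun _ => 0) (by simp [digit])]
    have : (fun k => if k = 0 then (i : ℕ) else j) =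
        fun k => ((if k = 0 then i else j : w.InPos) : ℕ) := by
      funext k; split_ifs <;> rfl
    rw [this]
  · exact hout
  · rintro (i | j)
    · simp [OGraph.org, OGraph.rank, orgNat]
    · simp [OGraph.org, OGraph.rank, orgNat, horg]

theorem exists_describes {s g : ℕ} (w : OGraph s g) :
    ∃ U < s ^ w.input.length, ∃ V < g ^ w.output.length,
      ∃ O < w.input.length ^ w.output.length,
        Describes w.input.length U w.output.length V O w := by
  obtain ⟨U, hU, hU'⟩ := exists_digits (B := s) (K := w.input.length)
    (d := fun k => if h : k < w.input.length then w.input.get ⟨k, h⟩ else 0)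
    (fun k hk => by rw [dif_pos hk]; exact Fin.is_lt _)
  obtain ⟨V, hV, hV'⟩ := exists_digits (B := g) (K := w.output.length)
    (d := fun k => if h : k < w.output.length then w.output.get ⟨k, h⟩ else 0)
    (fun k hk => by rw [dif_pos hk]; exact Fin.is_lt _)
  obtain ⟨O, hO, hO'⟩ := exists_digits (B := w.input.length) (K := w.output.length)
    (d := fun k => if h : k < w.output.length then w.origin ⟨k, h⟩ else 0)
    (fun k hk => by rw [dif_pos hk]; exact Fin.is_lt _)
  exact ⟨U, hU, V, hV, O, hO, rfl, fun i => by rw [hU' i i.2, dif_pos i.2], rfl,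
    fun j => by rw [hV' j j.2, dif_pos j.2], fun j => by rw [hO' j j.2, dif_pos j.2]⟩

theorem exists_graph_describes {s g n U m V : ℕ} (O : ℕ) (hn : 0 < n) (hU : U < s ^ n)
    (hV : V < g ^ m) : ∃ w : OGraph s g, Describes n U m V O w := by
  have hs : 0 < s := by
    rcases Nat.eq_zero_or_pos s with rfl | h
    · rw [zero_pow hn.ne'] at hU; omega
    · exact h
  have hg : 0 < m → 0 < g := by
    intro hm
    rcases Nat.eq_zero_or_pos g with rfl | h
    · rw [zero_pow hm.ne'] at hV; omega
    · exact h
  let input : List (Fin s) := List.ofFn fun i : Fin n => ⟨digit s U i, Nat.mod_lt _ hs⟩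
  let output : List (Fin g) := List.ofFn fun j : Fin m =>
    ⟨digit g V j, Nat.mod_lt _ (hg (by have := j.2; omega))⟩
  have hin : input.length = n := List.length_ofFn
  have hout : output.length = m := List.length_ofFn
  refine ⟨⟨input, by rw [← List.length_pos_iff, hin]; exact hn, output, fun j =>
    ⟨digit n O j, by rw [hin]; exact Nat.mod_lt _ hn⟩⟩, hin, fun i => ?_, hout, fun j => ?_,
    fun j => rfl⟩
  · simp [input]
  · simp [output]

/-- Bounded search for a model of the formula with Gödel number `c`. -/
def Sat (s g c : ℕ) : Prop :=
  ∃ n, n < OGraph.sizeBound (c + 1) g + 1 ∧ 0 < n ∧ ∃ U, U < s ^ n ∧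
    ∃ m, m < OGraph.sizeBound (c + 1) g + 1 ∧ ∃ V, V < g ^ m ∧ ∃ O, O < n ^ m ∧
      Check (s, n, U, g, m, V, O) (c * ((n + m) * (n + m)))

theorem sat_iff (s g : ℕ) (φ : LT) : Sat s g φ.code ↔ (φ.transduction s g).Nonempty := by
  constructor
  · rintro ⟨n, -, hn, U, hU, m, -, V, hV, O, -, h⟩
    obtain ⟨w, hw⟩ := exists_graph_describes O hn hU hV
    exact ⟨w, (hw.check_iff φ).mp h⟩
  · rintro ⟨w₀, hw₀⟩
    obtain ⟨w, hw, hin, hout⟩ := OGraph.exists_equivalent_length_le (φ.code + 1) w₀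
    have hφ := (hw φ (Nat.lt_succ_self _)).mpr hw₀
    obtain ⟨U, hU, V, hV, O, hO, h⟩ := exists_describes w
    exact ⟨_, Nat.lt_succ_of_le hin, List.length_pos_iff.mpr w.input_ne_nil, U, hU, _,
      Nat.lt_succ_of_le hout, V, hV, O, hO, (h.check_iff φ).mpr hφ⟩

@[fun_prop] theorem primrec_tower {α : Type} [Primcodable α] {f : α → ℕ} (hf : Primrec f) :
    Primrec fun a => tower (f a) := by
  have h : Primrec fun z : ℕ × ℕ => 2 ^ z.2 := by fun_prop
  refine (Primrec.nat_rec' (g := fun _ => 1) (h := fun _ x => 2 ^ x.2) hf (Primrec.const 1)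
    (h.comp Primrec.snd)).of_eq fun a => ?_
  induction f a with
  | zero => rfl
  | succ n ih => rw [tower, ← ih]

@[fun_prop] theorem primrecPred_sat {α : Type} [Primcodable α] {s g c : α → ℕ}
    (hs : Primrec s) (hg : Primrec g) (hc : Primrec c) :
    PrimrecPred fun a => Sat (s a) (g a) (c a) := by
  unfold Sat OGraph.sizeBound OGraph.profileBound
  fun_prop

@[fun_prop] theorem primrec_code {α : Type} [Primcodable α] {f : α → LT} (hf : Primrec f) :
    Primrec fun a => (f a).code :=
  Primrec.encode.comp hf

theorem primrecPred_isSentence_of_formula {α : Type} [Primcodable α] {s g : α → ℕ} {f : α → LT}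
    (hs : Primrec s) (hg : Primrec g) (hf : Primrec f) :
    PrimrecPred fun a => (f a).IsSentence (s a) (g a) :=
  (primrecPred_isSentence hs hg (primrec_code hf)).of_eq fun a => by rw [ofCode_code]

theorem transduction_neg (s g : ℕ) (φ : LT) :
    φ.neg.transduction s g = (φ.transduction s g)ᶜ := rfl

theorem transduction_and (s g : ℕ) (φ ψ : LT) :
    (φ.and ψ).transduction s g = φ.transduction s g ∩ ψ.transduction s g := rfl

theorem transduction_eq_iff (s g : ℕ) (φ ψ : LT) :
    φ.transduction s g = ψ.transduction s g ↔
      ¬ Sat s g (φ.and ψ.neg).code ∧ ¬ Sat s g (ψ.and φ.neg).code := by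
  rw [sat_iff, sat_iff, Set.not_nonempty_iff_eq_empty, Set.not_nonempty_iff_eq_empty,
    transduction_and, transduction_and, transduction_neg, transduction_neg, ← Set.sdiff_eq,
    ← Set.sdiff_eq, Set.sdiff_eq_empty, Set.sdiff_eq_empty]
  exact Set.Subset.antisymm_iff

end LT

end OriginLogic

theorem mainTheorem5 :
    -- satisfiability is decidable, uniformly in the two alphabets
    (ComputablePred fun p : ℕ × ℕ × OriginLogic.LT =>
      p.2.2.IsSentence p.1 p.2.1 ∧ (p.2.2.transduction p.1 p.2.1).Nonempty) ∧
    -- the logic is closed under negation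
    (∀ (s g : ℕ) (φ : OriginLogic.LT), φ.IsSentence s g →
      φ.neg.IsSentence s g ∧ φ.neg.transduction s g = (φ.transduction s g)ᶜ) ∧
    -- equivalence is decidable, uniformly in the two alphabets
    (ComputablePred fun p : ℕ × ℕ × OriginLogic.LT × OriginLogic.LT =>
      p.2.2.1.IsSentence p.1 p.2.1 ∧ p.2.2.2.IsSentence p.1 p.2.1 ∧
        p.2.2.1.transduction p.1 p.2.1 = p.2.2.2.transduction p.1 p.2.1) := by
  open OriginLogic LT in
  refine ⟨?_, fun s g φ h => ⟨h, rfl⟩, ?_⟩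
  · have h1 : PrimrecPred fun p : ℕ × ℕ × LT => p.2.2.IsSentence p.1 p.2.1 :=
      primrecPred_isSentence_of_formula (by fun_prop) (by fun_prop) (by fun_prop)
    have h2 : PrimrecPred fun p : ℕ × ℕ × LT => Sat p.1 p.2.1 p.2.2.code := by fun_prop
    obtain ⟨_, h⟩ := (h1.and h2).of_eq fun p => and_congr_right fun _ => sat_iff _ _ _
    exact ⟨inferInstance, h.to_comp⟩
  · have h1 : PrimrecPred fun p : ℕ × ℕ × LT × LT => p.2.2.1.IsSentence p.1 p.2.1 :=
      primrecPred_isSentence_of_formula (by fun_prop) (by fun_prop) (by fun_prop)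
    have h2 : PrimrecPred fun p : ℕ × ℕ × LT × LT => p.2.2.2.IsSentence p.1 p.2.1 :=
      primrecPred_isSentence_of_formula (by fun_prop) (by fun_prop) (by fun_prop)
    have h3 : PrimrecPred fun p : ℕ × ℕ × LT × LT =>
        ¬ Sat p.1 p.2.1 (p.2.2.1.and p.2.2.2.neg).code ∧
          ¬ Sat p.1 p.2.1 (p.2.2.2.and p.2.2.1.neg).code := by
      simp only [code]
      fun_prop
    obtain ⟨_, h⟩ := (h1.and (h2.and h3)).of_eq fun p => and_congr_right fun _ =>
      and_congr_right fun _ => (transduction_eq_iff _ _ _ _).symm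
    exact ⟨inferInstance, h.to_comp⟩
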